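/- Let $\mathcal H_S$ be a finite-dimensional complex Hilbert space (the system) and $\mathcal H_B$ a complex Hilbert space of arbitrary dimension (the bath), and let $$H_{\mathrm{tot}}(s)=H_S(s)\otimes 1+1\otimes H_B+H_I,\qquad s\in[0,1],$$ where $H_S(s)$, $H_B$ and $H_I$ are bounded self-adjoint operators on $\mathcal H_S$, $\mathcal H_B$ and $\mathcal H_S\otimes\mathcal H_B$, respectively, and only $H_S$ depends on the rescaled time $s$. Let $k\ge 0$ be an integer and assume that $s\mapsto H_S(s)$ is $C^{k+2}$ on $[0,1]$. Let $E(s)$ be a nondegenerate eigenvalue of $H_{\mathrm{tot}}(s)$, continuous in $s\in[0,1]$, with normalized eigenvector $|\phi(s)\rangle$, and assume that $E(s)$ is separated from the rest of the spectrum of $H_{\mathrm{tot}}(s)$ by a gap: there is $g>0$ such that $|\lambda-E(s)|\ge g$ for all $s\in[0,1]$ and all $\lambda\ne E(s)$ in the spectrum of $H_{\mathrm{tot}}(s)$. For $\tau>0$ let $|\psi_\tau(s)\rangle$ be the solution of the Schrödinger equation $i\,\partial_s|\psi_\tau(s)\rangle=\tau H_{\mathrm{tot}}(s)|\psi_\tau(s)\rangle$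 on $[0,1]$ with $|\psi_\tau(0)\rangle=|\phi(0)\rangle$, and put $\rho_\tau(s)=\operatorname{Tr}_B|\psi_\tau(s)\rangle\langle\psi_\tau(s)|$ and $\sigma(s)=\operatorname{Tr}_B|\phi(s)\rangle\langle\phi(s)|$. If $$H_S^{(j)}(0)=H_S^{(j)}(1)=0\qquad\text{for } j=1,\dots,k$$ (one-sided derivatives), then there is a constant $C_k$, independent of $\tau$, such that for all $\tau>0$ $$\|\rho_\tau(1)-\sigma(1)\|_1\le\frac{C_k}{\tau^{k+1}},$$ where $\|X\|_1=\operatorname{Tr}\sqrt{X^\dagger X}$ is the trace norm. -/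

import Mathlib

open scoped TensorProduct

/-!
Throughout, `S` is the finite-dimensional Hilbert space of the system and `B` the Hilbert space of
the bath.  Since `S` is finite-dimensional, the algebraic tensor product `S ⊗[ℂ] B` with Mathlib's
inner product `⟪x ⊗ u, y ⊗ v⟫ = ⟪x, y⟫ ⟪u, v⟫` is the Hilbert space tensor product.
-/

namespace AdiabaticBoundary

section TraceNorm

variable {S : Type*} [NormedAddCommGroup S] [InnerProductSpace ℂ S] [FiniteDimensional ℂ S]

/-- The trace norm `‖X‖₁ = Tr √(X† X)` of an operator on a finite-dimensional Hilbert space. -/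
noncomputable def traceNorm (X : S →L[ℂ] S) : ℝ :=
  haveI : CompleteSpace S := FiniteDimensional.complete ℂ S
  (LinearMap.trace ℂ S (CFC.sqrt (star X * X) : S →L[ℂ] S).toLinearMap).re

end TraceNorm

section Composite

variable {S B ι : Type*} [NormedAddCommGroup S] [InnerProductSpace ℂ S]
  [NormedAddCommGroup B] [InnerProductSpace ℂ B]

/-- `1 ⊗ |u⟩ : S → S ⊗ B`, `x ↦ x ⊗ u`. -/
noncomputable def bathKet (u : B) : S →L[ℂ] S ⊗[ℂ] B :=
  (TensorProduct.mkL ℂ S B).flip u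

/-- `1 ⊗ ⟨u| : S ⊗ B → S`, `x ⊗ v ↦ ⟪u, v⟫ x`. -/
noncomputable def bathBra (u : B) : S ⊗[ℂ] B →L[ℂ] S :=
  ((TensorProduct.ridIsometry ℂ S).toContinuousLinearEquiv : S ⊗[ℂ] ℂ →L[ℂ] S) ∘L
    (innerSL ℂ u).lTensor S

/-- The partial trace over the bath, `Tr_B T = ∑ᵢ (1 ⊗ ⟨bᵢ|) T (1 ⊗ |bᵢ⟩)`, for an orthonormal
(Hilbert) basis `b` of the bath.  For `T = |ψ⟩⟨χ|` the series converges and its sum does not depend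
on `b`, see `exists_hasSum_partialTrace_rankOne`. -/
noncomputable def partialTrace (b : HilbertBasis ι ℂ B) (T : S ⊗[ℂ] B →L[ℂ] S ⊗[ℂ] B) :
    S →L[ℂ] S :=
  ∑' i, bathBra (b i) ∘L T ∘L bathKet (b i)

/-- The reduced state `Tr_B |ψ⟩⟨ψ|` of a vector `ψ` of the composite system. -/
noncomputable def reducedState (b : HilbertBasis ι ℂ B) (ψ : S ⊗[ℂ] B) : S →L[ℂ] S :=
  partialTrace b (InnerProductSpace.rankOne ℂ ψ ψ)

/-- `H_tot = H_S ⊗ 1 + 1 ⊗ H_B + H_I`. -/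
noncomputable def totalHamiltonian (HS : S →L[ℂ] S) (HB : B →L[ℂ] B)
    (HI : S ⊗[ℂ] B →L[ℂ] S ⊗[ℂ] B) : S ⊗[ℂ] B →L[ℂ] S ⊗[ℂ] B :=
  HS.rTensor B + HB.lTensor S + HI

theorem bathKet_apply (u : B) (x : S) : bathKet u x = x ⊗ₜ[ℂ] u := rfl

theorem bathBra_tmul (u : B) (x : S) (v : B) :
    bathBra u (x ⊗ₜ[ℂ] v) = inner ℂ u v • x := by
  simp [bathBra]

theorem hasSum_partialTrace_rankOne [CompleteSpace B] (b : HilbertBasis ι ℂ B) (x y : S)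
    (u v : B) :
    HasSum (fun i => bathBra (b i) ∘L
        (InnerProductSpace.rankOne ℂ (x ⊗ₜ[ℂ] u) (y ⊗ₜ[ℂ] v)) ∘L bathKet (b i))
      (inner ℂ v u • InnerProductSpace.rankOne ℂ x y) := by
  have h := (b.hasSum_inner_mul_inner v u).smul_const
    (InnerProductSpace.rankOne ℂ x y : S →L[ℂ] S)
  convert h using 2 with i
  ext z
  simp [bathKet_apply, bathBra_tmul, smul_smul]
  ring_nf

/-- For every `T = |ψ⟩⟨χ|` the series defining `Tr_B T` converges, to the same operator for all
orthonormal bases of the bath. -/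
theorem exists_hasSum_partialTrace_rankOne [CompleteSpace B] (ψ χ : S ⊗[ℂ] B) :
    ∃ R : S →L[ℂ] S, ∀ b : HilbertBasis ι ℂ B,
      HasSum (fun i => bathBra (b i) ∘L (InnerProductSpace.rankOne ℂ ψ χ) ∘L bathKet (b i)) R := by
  induction ψ using TensorProduct.induction_on with
  | zero => exact ⟨0, fun b => by simp⟩
  | add ψ₁ ψ₂ h₁ h₂ =>
    obtain ⟨R₁, h₁⟩ := h₁
    obtain ⟨R₂, h₂⟩ := h₂
    refine ⟨R₁ + R₂, fun b => ?_⟩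
    simpa using (h₁ b).add (h₂ b)
  | tmul x u =>
    induction χ using TensorProduct.induction_on with
    | zero => exact ⟨0, fun b => by simp⟩
    | add χ₁ χ₂ h₁ h₂ =>
      obtain ⟨R₁, h₁⟩ := h₁
      obtain ⟨R₂, h₂⟩ := h₂
      refine ⟨R₁ + R₂, fun b => ?_⟩
      simpa using (h₁ b).add (h₂ b)
    | tmul y v => exact ⟨_, fun b => hasSum_partialTrace_rankOne b x y u v⟩

end Composite

section Dynamics

variable {K : Type*} [NormedAddCommGroup K] [InnerProductSpace ℂ K]

/-- `E(s)`, `s ∈ [0,1]`, is a nondegenerate energy level of the Hamiltonian `H(s)` with normalized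
eigenvector `φ(s)`: it depends continuously on `s`, the eigenspace is one-dimensional, and the level
is separated from the rest of the spectrum by a gap, uniformly in `s`. -/
structure IsGappedLevel (H : ℝ → K →L[ℂ] K) (E : ℝ → ℝ) (φ : ℝ → K) : Prop where
  continuousOn_energy : ContinuousOn E (Set.Icc 0 1)
  norm_eq_one : ∀ s ∈ Set.Icc (0 : ℝ) 1, ‖φ s‖ = 1
  eigen : ∀ s ∈ Set.Icc (0 : ℝ) 1, H s (φ s) = (E s : ℂ) • φ s
  nondegenerate : ∀ s ∈ Set.Icc (0 : ℝ) 1, ∀ v : K, H s v = (E s : ℂ) • v → ∃ c : ℂ, v = c • φ s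
  gap : ∃ g : ℝ, 0 < g ∧ ∀ s ∈ Set.Icc (0 : ℝ) 1, ∀ z ∈ spectrum ℂ (H s),
    z ≠ (E s : ℂ) → g ≤ ‖z - (E s : ℂ)‖

/-- `ψ` solves the Schrödinger equation `i ψ'(s) = τ H(s) ψ(s)` in rescaled time `s ∈ [0,1]`
(units with `ħ = 1`). -/
def IsSchrodingerSolution (H : ℝ → K →L[ℂ] K) (τ : ℝ) (ψ : ℝ → K) : Prop :=
  ∀ s ∈ Set.Icc (0 : ℝ) 1,
    HasDerivWithinAt ψ (-(Complex.I * (τ : ℂ)) • H s (ψ s)) (Set.Icc 0 1) s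

end Dynamics

end AdiabaticBoundary

/-! Compare the Schrödinger solution with a truncated adiabatic expansion whose corrections
disappear at both endpoints.

Choose the phase of the eigenvector by parallel transport, giving `y` with `⟪y, y'⟫ = 0`
(`exists_parallel_frame`). Apart from the dynamical phase, the solution is sought as `y + ∑ τ⁻ʲ uⱼ`
with `(H - E) uⱼ₊₁ = i uⱼ'` and `u₀ = y`. This is solvable when `uⱼ' ⟂ y`; the solution is `a y +
w`, with `w` given by the reduced resolvent and `a` fixed by requiring `uⱼ₊₁' ⟂ y`
(`exists_next_order`).

Since `y'` is linear in `H'`, it inherits the vanishing of `H'` to order `k` at the endpoints. Each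
step of the recursion costs one order of flatness and one derivative, so `w` vanishes at 0 and 1 in
the first `k` corrections. The sum then starts at `y 0` and ends on the line of `y 1`. One further
correction leaves a residual and endpoint errors of size `τ⁻⁽ᵏ⁺¹⁾` (`exists_approximate_solution`);
unitarity of the dynamics carries this bound to the true solution
(`norm_le_add_of_hasDerivWithinAt`, `exists_adiabatic_bound`).

The remaining phase is invisible to the reduced state. The partial trace of `|ψ⟩⟨χ|` has operator
norm at most `‖ψ‖ ‖χ‖`, and on the system the trace norm is at most `dim S` times the operator norm.
-/

namespace AdiabaticBoundary

open Set Filter Topology InnerProductSpace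

/-! ### Antiderivatives and linear differential equations on the unit interval. -/

section Calculus

variable {F : Type*} [NormedAddCommGroup F] [NormedSpace ℝ F]

/-- The extension is constant beyond each endpoint. The last clause lets bounds on the interval pass
to all of `ℝ`. -/
theorem exists_continuous_eqOn_unitInterval {X : Type*} [TopologicalSpace X] {f : ℝ → X}
    (hf : ContinuousOn f (Icc 0 1)) :
    ∃ g : ℝ → X, Continuous g ∧ (∀ s ∈ Icc (0 : ℝ) 1, g s = f s) ∧
      ∀ s, ∃ t ∈ Icc (0 : ℝ) 1, g s = f t := by
  refine ⟨IccExtend zero_le_one (domRestrict (Icc (0 : ℝ) 1) f),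
    (continuousOn_iff_continuous_domRestrict.1 hf).Icc_extend', fun s hs => ?_, fun s => ?_⟩
  · rw [IccExtend_of_mem _ _ hs]; rfl
  · exact ⟨_, (projIcc (0 : ℝ) 1 zero_le_one s).2, rfl⟩

theorem exists_antideriv_unitInterval [CompleteSpace F] {f : ℝ → F}
    (hf : ContinuousOn f (Icc 0 1)) :
    ∃ A : ℝ → F, A 0 = 0 ∧ ∀ s ∈ Icc (0 : ℝ) 1, HasDerivWithinAt A (f s) (Icc 0 1) s := by
  obtain ⟨g, hg, hgf, -⟩ := exists_continuous_eqOn_unitInterval hf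
  refine ⟨fun s => ∫ t in (0 : ℝ)..s, g t, by simp, fun s hs => ?_⟩
  rw [← hgf s hs]
  exact (hg.integral_hasStrictDerivAt 0 s).hasDerivAt.hasDerivWithinAt

theorem norm_le_of_hasDerivAt_le {f f' : ℝ → F} {B b : ℝ → ℝ}
    (hf : ∀ t, HasDerivAt f (f' t) t) (hB : ∀ t, HasDerivAt B (b t) t)
    (h0 : ‖f 0‖ ≤ B 0) (hb : ∀ t, 0 ≤ t → ‖f' t‖ ≤ b t) {t : ℝ} (ht : 0 ≤ t) : ‖f t‖ ≤ B t :=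
  image_norm_le_of_norm_deriv_right_le_deriv_boundary
    (fun x _ => (hf x).continuousAt.continuousWithinAt) (fun x _ => (hf x).hasDerivWithinAt) h0
    hB (fun x hx => hb x hx.1) ⟨ht, le_rfl⟩

theorem hasDerivAt_pow_div_factorial (c L : ℝ) (n : ℕ) (t : ℝ) :
    HasDerivAt (fun t => c * (L * t) ^ (n + 1) / (n + 1).factorial)
      (L * (c * (L * t) ^ n / n.factorial)) t := by
  have h := ((((hasDerivAt_id t).const_mul L).pow (n + 1)).const_mul c).div_const
    ((n + 1).factorial : ℝ)
  refine h.congr_deriv ?_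
  have : (n.factorial : ℝ) ≠ 0 := by positivity
  rw [Nat.factorial_succ]
  push_cast
  field_simp
  simp

/-- Global solvability of linear differential equations, by summing the Picard iterates. -/
theorem exists_linearODE_solution [CompleteSpace F] {M : ℝ → F →L[ℝ] F}
    (hM : ContinuousOn M (Icc 0 1)) (x : F) :
    ∃ y : ℝ → F, y 0 = x ∧ ∀ s ∈ Icc (0 : ℝ) 1, HasDerivWithinAt y (M s (y s)) (Icc 0 1) s := by
  obtain ⟨N, hN, hNM, hNr⟩ := exists_continuous_eqOn_unitInterval hM
  obtain ⟨L, hL⟩ := isCompact_Icc.exists_bound_of_continuousOn hM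
  have hNL : ∀ s, ‖N s‖ ≤ L := fun s => by
    obtain ⟨t, ht, h⟩ := hNr s
    rw [h]; exact hL t ht
  have hL0 : 0 ≤ L := (norm_nonneg _).trans (hNL 0)
  let Y : ℕ → ℝ → F := fun n => Nat.rec (fun _ => x) (fun _ f t => ∫ u in (0 : ℝ)..t, N u (f u)) n
  have hYs : ∀ n, Y (n + 1) = fun t => ∫ u in (0 : ℝ)..t, N u (Y n u) := fun n => rfl
  have hYd : ∀ n, Continuous (Y n) → ∀ t, HasDerivAt (Y (n + 1)) (N t (Y n t)) t := fun n hn t =>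
    ((hN.clm_apply hn).integral_hasStrictDerivAt 0 t).hasDerivAt
  have hYc : ∀ n, Continuous (Y n) := fun n => by
    induction n with
    | zero => exact continuous_const
    | succ n ih => exact continuous_iff_continuousAt.2 fun t => (hYd n ih t).continuousAt
  have hY0 : ∀ n, Y (n + 1) 0 = 0 := fun n => by rw [hYs]; simp
  have hbound : ∀ n t, 0 ≤ t → ‖Y n t‖ ≤ ‖x‖ * (L * t) ^ n / n.factorial ∧
      ‖Y n (-t)‖ ≤ ‖x‖ * (L * t) ^ n / n.factorial := fun n => by
    induction n with
    | zero => intro t _; simp [Y]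
    | succ n ih =>
      intro t ht
      constructor
      · refine norm_le_of_hasDerivAt_le (hYd n (hYc n))
          (hasDerivAt_pow_div_factorial ‖x‖ L n) (by simp [hY0]) (fun u hu => ?_) ht
        exact (N u).le_of_opNorm_le_of_le (hNL u) (ih u hu).1
      · refine norm_le_of_hasDerivAt_le (f := fun u => Y (n + 1) (-u))
          (fun u => (hYd n (hYc n) (-u)).scomp u (hasDerivAt_neg u))
          (hasDerivAt_pow_div_factorial ‖x‖ L n) (by simp [hY0]) (fun u hu => ?_) ht
        simpa using (N (-u)).le_of_opNorm_le_of_le (hNL (-u)) (ih u hu).2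
  -- Termwise differentiation of the series needs an open interval; any bounded one containing
  -- `[0,1]` would do.
  have hb2 : ∀ n, ∀ t ∈ Ioo (-2 : ℝ) 2, ‖Y n t‖ ≤ ‖x‖ * (L * 2) ^ n / n.factorial := by
    intro n t ht
    have key : ‖Y n t‖ ≤ ‖x‖ * (L * |t|) ^ n / n.factorial := by
      rcases le_total 0 t with h | h
      · rw [abs_of_nonneg h]; exact (hbound n t h).1
      · rw [abs_of_nonpos h]
        simpa using (hbound n (-t) (by linarith)).2
    refine key.trans ?_
    have : |t| ≤ 2 := abs_le.2 ⟨ht.1.le, ht.2.le⟩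
    gcongr
  have hsum : Summable fun n : ℕ => ‖x‖ * (L * 2) ^ n / n.factorial := by
    simpa [mul_div_assoc] using (Real.summable_pow_div_factorial (L * 2)).mul_left ‖x‖
  let Y' : ℕ → ℝ → F := fun n => Nat.casesOn n (fun _ => 0) (fun n t => N t (Y n t))
  have hu : Summable fun n : ℕ =>
      (Nat.casesOn n 0 fun m : ℕ => L * (‖x‖ * (L * 2) ^ m / m.factorial) : ℝ) :=
    (summable_nat_add_iff 1).1 (hsum.mul_left L)
  have hYsum : ∀ t ∈ Ioo (-2 : ℝ) 2, Summable fun n => Y n t := fun t ht =>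
    Summable.of_norm_bounded hsum fun n => hb2 n t ht
  refine ⟨fun t => ∑' n, Y n t, ?_, fun s hs => ?_⟩
  · refine (tsum_eq_single 0 fun n hn => ?_).trans rfl
    obtain ⟨m, rfl⟩ := Nat.exists_eq_succ_of_ne_zero hn
    exact hY0 m
  · have hs2 : s ∈ Ioo (-2 : ℝ) 2 := ⟨by linarith [hs.1], by linarith [hs.2]⟩
    have h := hasDerivAt_tsum_of_isPreconnected (g := Y) (g' := Y') (y₀ := 0) (y := s) hu
      isOpen_Ioo isPreconnected_Ioo (fun n t ht => by
        cases n with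
        | zero => exact hasDerivAt_const t x
        | succ n => exact hYd n (hYc n) t) (fun n t ht => by
        cases n with
        | zero => simp [Y']
        | succ n => exact (N t).le_of_opNorm_le_of_le (hNL t) (hb2 n t ht))
      (by norm_num) (hYsum 0 (by norm_num)) hs2
    refine (h.congr_deriv ?_).hasDerivWithinAt
    have hsumY' : Summable fun n => Y' n s := (summable_nat_add_iff 1).1
      ((N s).summable (hYsum s hs2))
    rw [hsumY'.tsum_eq_zero_add, ← hNM s hs, (N s).map_tsum (hYsum s hs2)]
    simp [Y']

end Calculus

/-! ### Vanishing of derivatives at the endpoints. -/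

section Flatness

variable {F G W : Type*} [NormedAddCommGroup F] [NormedSpace ℝ F]
  [NormedAddCommGroup G] [NormedSpace ℝ G] [NormedAddCommGroup W] [NormedSpace ℝ W]

/-- The derivatives of order less than `n` of a function on `[0,1]` vanish at both endpoints. -/
def FlatAtEnds (n : ℕ) (f : ℝ → F) : Prop :=
  ∀ i < n, ∀ x ∈ ({0, 1} : Set ℝ), iteratedDerivWithin i f (Icc 0 1) x = 0

theorem mem_unitInterval_of_mem_ends {x : ℝ} (hx : x ∈ ({0, 1} : Set ℝ)) :
    x ∈ Icc (0 : ℝ) 1 := by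
  rcases hx with rfl | rfl <;> simp

theorem uniqueDiffOn_unitInterval : UniqueDiffOn ℝ (Icc (0 : ℝ) 1) :=
  uniqueDiffOn_Icc zero_lt_one

theorem FlatAtEnds.mono {n m : ℕ} {f : ℝ → F} (h : FlatAtEnds n f) (hm : m ≤ n) :
    FlatAtEnds m f := fun i hi => h i (hi.trans_le hm)

theorem FlatAtEnds.eq_zero {n : ℕ} {f : ℝ → F} (h : FlatAtEnds n f) (hn : 0 < n) {x : ℝ}
    (hx : x ∈ ({0, 1} : Set ℝ)) : f x = 0 := by
  simpa using h 0 hn x hx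

theorem FlatAtEnds.congr {n : ℕ} {f g : ℝ → F} (h : FlatAtEnds n f)
    (hfg : EqOn g f (Icc 0 1)) : FlatAtEnds n g := fun i hi x hx => by
  rw [iteratedDerivWithin_congr hfg (mem_unitInterval_of_mem_ends hx)]
  exact h i hi x hx

theorem FlatAtEnds.derivWithin {n : ℕ} {f : ℝ → F} (h : FlatAtEnds n f) :
    FlatAtEnds (n - 1) (derivWithin f (Icc 0 1)) := fun i hi x hx => by
  rw [← iteratedDerivWithin_succ']
  exact h (i + 1) (by omega) x hx

theorem FlatAtEnds.add {n m : ℕ} {f g : ℝ → F} (hf : FlatAtEnds n f) (hg : FlatAtEnds n g)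
    (hfm : ContDiffOn ℝ m f (Icc 0 1)) (hgm : ContDiffOn ℝ m g (Icc 0 1)) (hn : n ≤ m + 1) :
    FlatAtEnds n (fun s => f s + g s) := fun i hi x hx => by
  have hxI := mem_unitInterval_of_mem_ends hx
  have him : ((i : ℕ) : WithTop ℕ∞) ≤ (m : ℕ) := by exact_mod_cast (by omega : i ≤ m)
  rw [iteratedDerivWithin_fun_add hxI uniqueDiffOn_unitInterval
    ((hfm x hxI).of_le him) ((hgm x hxI).of_le him), hf i hi x hx, hg i hi x hx, add_zero]

/-- Flatness of one factor suffices: every Leibniz term of order `i < n` contains a derivative of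
`g` of order at most `i`. Only orders below `n` occur, hence `n ≤ m + 1`. -/
theorem FlatAtEnds.bilinear {n m : ℕ} {f : ℝ → F} {g : ℝ → G} (B : F →L[ℝ] G →L[ℝ] W)
    (hg : FlatAtEnds n g)
    (hfm : ContDiffOn ℝ m f (Icc 0 1)) (hgm : ContDiffOn ℝ m g (Icc 0 1)) (hn : n ≤ m + 1) :
    FlatAtEnds n (fun s => B (f s) (g s)) := fun i hi x hx => by
  have hxI := mem_unitInterval_of_mem_ends hx
  have him : ((i : ℕ) : WithTop ℕ∞) ≤ (m : ℕ) := by exact_mod_cast (by omega : i ≤ m)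
  rw [← norm_eq_zero, ← norm_iteratedFDerivWithin_eq_norm_iteratedDerivWithin]
  refine le_antisymm ?_ (norm_nonneg _)
  refine (B.norm_iteratedFDerivWithin_le_of_bilinear hfm hgm uniqueDiffOn_unitInterval hxI
    him).trans (le_of_eq ?_)
  rw [Finset.sum_eq_zero, mul_zero]
  intro l _
  rw [norm_iteratedFDerivWithin_eq_norm_iteratedDerivWithin (n := i - l) (f := g),
    hg (i - l) (by omega) x hx, norm_zero, mul_zero]

theorem FlatAtEnds.clm_comp {n m : ℕ} {g : ℝ → G} (B : G →L[ℝ] W)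
    (hg : FlatAtEnds n g) (hgm : ContDiffOn ℝ m g (Icc 0 1)) (hn : n ≤ m + 1) :
    FlatAtEnds n (fun s => B (g s)) :=
  hg.bilinear (f := fun _ => B) (ContinuousLinearMap.id ℝ _) contDiffOn_const hgm hn

end Flatness

/-! ### Energy estimate for a perturbed Schrödinger equation. -/

section Energy

variable {K : Type*} [NormedAddCommGroup K] [InnerProductSpace ℂ K]

theorem re_inner_I_smul_symmetric {T : K →L[ℂ] K} (hT : T.toLinearMap.IsSymmetric) (τ : ℝ)
    (v : K) : (inner ℂ v (-(Complex.I * (τ : ℂ)) • T v)).re = 0 := by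
  have h : (inner ℂ v (T v)).im = 0 := by
    have h1 := hT v v
    have h2 := inner_conj_symm (𝕜 := ℂ) v (T v)
    simp only [ContinuousLinearMap.coe_coe] at h1
    rw [h1] at h2
    exact Complex.conj_eq_iff_im.1 h2
  simp [inner_smul_right, h]

/-- The Hamiltonian term is skew-adjoint and drops out of the derivative of `‖d‖²`, so the bound
does not depend on `τ`. The norm is regularised to `√(‖d‖² + ε²)`, which stays differentiable where
`d` vanishes. -/
theorem norm_le_add_of_hasDerivWithinAt {H : ℝ → K →L[ℂ] K} {d r : ℝ → K} {τ ρ : ℝ}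
    (hH : ∀ s ∈ Icc (0 : ℝ) 1, (H s).toLinearMap.IsSymmetric)
    (hd : ∀ s ∈ Icc (0 : ℝ) 1,
      HasDerivWithinAt d (-(Complex.I * (τ : ℂ)) • H s (d s) + r s) (Icc 0 1) s)
    (hr : ∀ s ∈ Icc (0 : ℝ) 1, ‖r s‖ ≤ ρ) : ‖d 1‖ ≤ ‖d 0‖ + ρ := by
  have key : ∀ ε : ℝ, 0 < ε → ‖d 1‖ ≤ ‖d 0‖ + ε + ρ := by
    intro ε hε
    let f : ℝ → ℝ := fun s => √((inner ℂ (d s) (d s)).re + ε ^ 2)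
    have hinn : ∀ v : K, (inner ℂ v v).re = ‖v‖ ^ 2 := fun v => by
      rw [← inner_self_eq_norm_sq (𝕜 := ℂ)]; rfl
    have hpos : ∀ s, 0 < (inner ℂ (d s) (d s)).re + ε ^ 2 := fun s => by
      rw [hinn]; positivity
    have hf : ∀ s ∈ Icc (0 : ℝ) 1,
        HasDerivWithinAt f ((inner ℂ (d s) (r s)).re / f s) (Icc 0 1) s := by
      intro s hs
      have h1 := (hd s hs).inner ℂ (hd s hs)
      have h2 := (Complex.reCLM.hasFDerivAt.comp_hasDerivWithinAt s h1).add_const (ε ^ 2)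
      have h3 := h2.sqrt (hpos s).ne'
      refine h3.congr_deriv ?_
      have e : (inner ℂ (-(Complex.I * (τ : ℂ)) • H s (d s) + r s) (d s)).re
          = (inner ℂ (d s) (-(Complex.I * (τ : ℂ)) • H s (d s) + r s)).re := by
        rw [← inner_conj_symm, Complex.conj_re]
      have e2 : (inner ℂ (d s) (-(Complex.I * (τ : ℂ)) • H s (d s) + r s)).re
          = (inner ℂ (d s) (r s)).re := by
        rw [inner_add_right, Complex.add_re, re_inner_I_smul_symmetric (hH s hs), zero_add]
      simp only [Complex.reCLM_apply, Complex.add_re, e, e2, Function.comp_apply]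
      change _ / (2 * f s) = _ / f s
      rw [← two_mul, mul_div_mul_left _ _ two_ne_zero]
    have hfd : ∀ s, ‖d s‖ ≤ f s := fun s => by
      refine Real.le_sqrt_of_sq_le ?_
      rw [hinn]; nlinarith
    have hb : ∀ s ∈ Ico (0 : ℝ) 1, ‖(inner ℂ (d s) (r s)).re / f s‖ ≤ ρ := by
      intro s hs
      have hfs : 0 < f s := Real.sqrt_pos.2 (hpos s)
      rw [norm_div, Real.norm_of_nonneg hfs.le, div_le_iff₀ hfs]
      calc ‖(inner ℂ (d s) (r s)).re‖ ≤ ‖d s‖ * ‖r s‖ :=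
            (Complex.abs_re_le_norm _).trans (norm_inner_le_norm _ _)
        _ ≤ f s * ρ := mul_le_mul (hfd s) (hr s ⟨hs.1, hs.2.le⟩) (norm_nonneg _) hfs.le
        _ = ρ * f s := mul_comm _ _
    have h1 := norm_image_sub_le_of_norm_deriv_le_segment' hf hb 1 (by simp)
    have h0 : f 0 ≤ ‖d 0‖ + ε := by
      refine Real.sqrt_le_iff.2 ⟨by positivity, ?_⟩
      rw [hinn]; nlinarith [norm_nonneg (d 0)]
    have := hfd 1
    have := (abs_le.1 h1).2
    linarith
  refine le_of_forall_pos_le_add fun ε hε => ?_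
  linarith [key ε hε]

end Energy

/-! ### Isolated simple eigenvalues and rank-one projections. -/

section GappedEigenvalue

variable {K : Type*} [NormedAddCommGroup K] [InnerProductSpace ℂ K]

/-- `T - e + |φ⟩⟨φ|`. -/
noncomputable def bordered (T : K →L[ℂ] K) (e : ℂ) (φ : K) : K →L[ℂ] K :=
  T - e • 1 + rankOne ℂ φ φ

theorem bordered_apply (T : K →L[ℂ] K) (e : ℂ) (φ x : K) :
    bordered T e φ x = T x - e • x + inner ℂ φ x • φ := by
  simp [bordered]

/-- Adding the projection repairs the one-dimensional kernel of `T - e`. The inverse acts as the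
reduced resolvent on the orthogonal complement of `φ`, and as a genuine inverse it depends smoothly
on the operator. -/
theorem isUnit_bordered [CompleteSpace K] {T : K →L[ℂ] K} (hT : T.toLinearMap.IsSymmetric)
    {e : ℝ} {φ : K}
    (hφ : ‖φ‖ = 1) (heig : T φ = (e : ℂ) • φ)
    (hnd : ∀ v : K, T v = (e : ℂ) • v → ∃ c : ℂ, v = c • φ) {g : ℝ} (hg : 0 < g)
    (hgap : ∀ z ∈ spectrum ℂ T, z ≠ (e : ℂ) → g ≤ ‖z - (e : ℂ)‖) :
    IsUnit (bordered T e φ) := by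
  have hTs : IsSelfAdjoint T := ContinuousLinearMap.isSelfAdjoint_iff_isSymmetric.2 hT
  have hTn : IsStarNormal T := hTs.isStarNormal
  -- The value at `z = e` is `0⁻¹ = 0`; continuity there holds because the gap isolates `e` in the
  -- spectrum.
  have hcont : ContinuousOn (fun z : ℂ => (z - e)⁻¹) (spectrum ℂ T) := by
    intro z hz
    by_cases hze : z = e
    · have : (fun _ => ((e : ℂ) - e)⁻¹) =ᶠ[𝓝[spectrum ℂ T] z] (fun z : ℂ => (z - e)⁻¹) := by
        have hb : Metric.ball (e : ℂ) g ∈ 𝓝[spectrum ℂ T] z :=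
          mem_nhdsWithin_of_mem_nhds (hze ▸ Metric.ball_mem_nhds _ hg)
        filter_upwards [hb, self_mem_nhdsWithin] with w hw hws
        by_cases hwe : w = e
        · rw [hwe]
        · exact absurd (hgap w hws hwe) (not_le.2 (by simpa [dist_eq_norm] using hw))
      subst hze
      exact continuousWithinAt_const.congr_of_eventuallyEq this.symm rfl
    · exact ((continuous_id.sub continuous_const).continuousAt.inv₀
        (sub_ne_zero.2 hze)).continuousWithinAt
  have hlin : ContinuousOn (fun z : ℂ => z - e) (spectrum ℂ T) := by fun_prop
  let R := cfc (fun z : ℂ => (z - e)⁻¹) T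
  let h := T - (e : ℂ) • (1 : K →L[ℂ] K)
  have hh : cfc (fun z : ℂ => z - e) T = h := by
    rw [cfc_sub (fun z : ℂ => z) (fun _ => (e : ℂ)) T, cfc_id' ℂ T, cfc_const (e : ℂ) T]
    simp [h, Algebra.algebraMap_eq_smul_one]
  have hcomm : h * R = R * h := by
    rw [← hh]; exact (cfc_commute_cfc _ _ T).eq
  have hRh : h * (R * h) = h := by
    rw [← hh, ← cfc_mul (fun z : ℂ => (z - e)⁻¹) (fun z : ℂ => z - e) T hcont hlin,
      ← cfc_mul (fun z : ℂ => z - e) (fun z : ℂ => (z - e)⁻¹ * (z - e)) T hlin (hcont.mul hlin)]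
    congr 1
    ext z
    by_cases hz : z - (e : ℂ) = 0
    · simp [hz]
    · field_simp
  have hφ1 : inner ℂ φ φ = (1 : ℂ) := by rw [inner_self_eq_norm_sq_to_K, hφ]; simp
  have hhφ : h φ = 0 := by simp [h, heig]
  have hhs : ∀ x y, inner ℂ (h x) y = inner ℂ x (h y) := fun x y => by
    have := hT x y
    simp only [ContinuousLinearMap.coe_coe] at this
    simp [h, this]
  -- The range of `1 - R h` lies in the kernel of `h`, which is the line of `φ`; the coefficient is
  -- found by pairing with `φ`.
  have hproj : 1 - R * h = rankOne ℂ φ φ := by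
    ext x
    have hker : h ((1 - R * h) x) = 0 := by
      change (h * (1 - R * h)) x = 0
      rw [mul_sub, hRh, mul_one, sub_self]; rfl
    obtain ⟨c, hc⟩ := hnd ((1 - R * h) x) (by
      rw [← sub_eq_zero]; simpa [h] using hker)
    have hin : inner ℂ φ ((1 - R * h) x) = inner ℂ φ x := by
      rw [← hcomm]
      simp [← hhs, hhφ]
    rw [rankOne_apply, ← hin, hc]
    simp [hφ]
  have hP2 : rankOne ℂ φ φ * rankOne ℂ φ φ = rankOne ℂ φ φ := isIdempotentElem_rankOne_self hφ
  have hhP : h * rankOne ℂ φ φ = 0 := by ext x; simp [hhφ]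
  have hPh : rankOne ℂ φ φ * h = 0 := by ext x; simp [← hhs, hhφ]
  have hQ : R * h = 1 - rankOne ℂ φ φ := by rw [← hproj]; abel
  -- The extra factor `R h`, the projection off `φ`, makes the cross terms with the projection
  -- vanish by algebra alone.
  refine isUnit_iff_exists.2 ⟨R * (R * h) + rankOne ℂ φ φ, ?_, ?_⟩
  · change (h + rankOne ℂ φ φ) * _ = 1
    have e1 : h * (R * (R * h)) = R * h := by
      rw [← mul_assoc h R, hcomm, mul_assoc R h, hRh]
    have e2 : rankOne ℂ φ φ * (R * (R * h)) = 0 := by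
      rw [← hcomm, ← mul_assoc R, ← hcomm, ← mul_assoc, ← mul_assoc, hPh, zero_mul, zero_mul]
    rw [mul_add, add_mul, add_mul, e1, e2, hhP, hP2, hQ]
    abel
  · change _ * (h + rankOne ℂ φ φ) = 1
    have e1 : R * (R * h) * h = R * h := by
      have : R * h * h = h := by rw [← hcomm, mul_assoc, hRh]
      rw [mul_assoc, this]
    have e2 : R * (R * h) * rankOne ℂ φ φ = 0 := by
      rw [mul_assoc, mul_assoc, hhP, mul_zero, mul_zero]
    rw [mul_add, add_mul, add_mul, e1, e2, hPh, hP2, hQ]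
    abel

variable {T : K →L[ℂ] K} {e : ℝ} {φ : K}

theorem inner_self_eq_one {φ : K} (hφ : ‖φ‖ = 1) : inner ℂ φ φ = (1 : ℂ) := by
  rw [inner_self_eq_norm_sq_to_K, hφ]; simp

theorem inner_sub_smul_eq_zero (hT : T.toLinearMap.IsSymmetric) (heig : T φ = (e : ℂ) • φ)
    (x : K) : inner ℂ φ (T x - (e : ℂ) • x) = 0 := by
  have := hT φ x
  simp only [ContinuousLinearMap.coe_coe] at this
  rw [inner_sub_right, ← this, heig, inner_smul_left, inner_smul_right]
  simp

theorem inverse_bordered_apply_apply (hG : IsUnit (bordered T e φ)) (x : K) :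
    Ring.inverse (bordered T e φ) (bordered T e φ x) = x :=
  congr($(Ring.inverse_mul_cancel _ hG) x)

theorem bordered_apply_inverse_apply (hG : IsUnit (bordered T e φ)) (x : K) :
    bordered T e φ (Ring.inverse (bordered T e φ) x) = x :=
  congr($(Ring.mul_inverse_cancel _ hG) x)

theorem inverse_bordered_self (hφ : ‖φ‖ = 1) (heig : T φ = (e : ℂ) • φ)
    (hG : IsUnit (bordered T e φ)) : Ring.inverse (bordered T e φ) φ = φ := by
  have h : bordered T e φ φ = φ := by
    rw [bordered_apply, heig, inner_self_eq_one hφ]; simp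
  conv_lhs => rw [← h]
  rw [h]
  simpa [h] using inverse_bordered_apply_apply hG φ

theorem inverse_bordered_sub (hφ : ‖φ‖ = 1) (heig : T φ = (e : ℂ) • φ)
    (hG : IsUnit (bordered T e φ)) (x : K) :
    Ring.inverse (bordered T e φ) (T x - (e : ℂ) • x) = x - inner ℂ φ x • φ := by
  have h := inverse_bordered_apply_apply hG x
  rw [bordered_apply, map_add, map_smul, inverse_bordered_self hφ heig hG] at h
  exact eq_sub_of_add_eq h

theorem inner_inverse_bordered (hT : T.toLinearMap.IsSymmetric) (hφ : ‖φ‖ = 1)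
    (heig : T φ = (e : ℂ) • φ) (hG : IsUnit (bordered T e φ)) (x : K) :
    inner ℂ φ (Ring.inverse (bordered T e φ) x) = inner ℂ φ x := by
  have h := bordered_apply_inverse_apply hG x
  conv_rhs => rw [← h]
  rw [bordered_apply, inner_add_right, inner_sub_smul_eq_zero hT heig, inner_smul_right,
    inner_self_eq_one hφ, zero_add, mul_one]

theorem sub_inverse_bordered (hT : T.toLinearMap.IsSymmetric) (hφ : ‖φ‖ = 1)
    (heig : T φ = (e : ℂ) • φ) (hG : IsUnit (bordered T e φ)) (x : K) :
    T (Ring.inverse (bordered T e φ) x) - (e : ℂ) • Ring.inverse (bordered T e φ) x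
      = x - inner ℂ φ x • φ := by
  have h := bordered_apply_inverse_apply hG x
  rw [bordered_apply, inner_inverse_bordered hT hφ heig hG] at h
  exact eq_sub_of_add_eq h

theorem rankOne_self_sub (u v : K) :
    rankOne ℂ u u - rankOne ℂ v v = rankOne ℂ (u - v) u + rankOne ℂ v (u - v) := by
  simp

theorem rankOne_smul_self_of_unit {z : ℂ} (hz : ‖z‖ = 1) (u : K) :
    rankOne ℂ (z • u) (z • u) = rankOne ℂ u u := by
  ext x
  have hzz : (starRingEnd ℂ) z * z = 1 := by rw [Complex.conj_mul', hz]; simp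
  rw [rankOne_apply, rankOne_apply, inner_smul_left, smul_smul, mul_right_comm, hzz, one_mul]

theorem norm_rankOne_self_sub_le (u v : K) :
    ‖rankOne ℂ u u - rankOne ℂ v v‖ ≤ ‖u - v‖ * (‖u‖ + ‖v‖) := by
  rw [rankOne_self_sub]
  refine (norm_add_le _ _).trans_eq ?_
  simp only [norm_rankOne]; ring

theorem sub_smul_self {V : Type*} [AddCommGroup V] [Module ℂ V] (c : ℂ) (x : V) :
    c • x - x = (c - 1) • x := by
  rw [sub_smul, one_smul]

/-- Pass through `c v` with `c = ⟪v, u⟫`. Both `‖u - c v‖ (1 + ‖c‖)` and `1 - ‖c‖²` are at most `2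
‖u - c v‖`, as `1 - ‖c‖ ≤ ‖u - c v‖`. -/
theorem norm_rankOne_self_sub_le_of_unit {u v : K} (hu : ‖u‖ = 1) (hv : ‖v‖ = 1) :
    ‖rankOne ℂ u u - rankOne ℂ v v‖ ≤ 4 * ‖u - inner ℂ v u • v‖ := by
  set c := inner ℂ v u with hc
  have hc1 : ‖c‖ ≤ 1 := by simpa [hu, hv] using norm_inner_le_norm (𝕜 := ℂ) v u
  have hcv : ‖c • v‖ = ‖c‖ := by rw [norm_smul, hv, mul_one]
  have h1 : 1 ≤ ‖u - c • v‖ + ‖c‖ := by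
    have := norm_add_le (u - c • v) (c • v)
    rwa [sub_add_cancel, hu, hcv] at this
  have e : rankOne ℂ (c • v) (c • v) = ((‖c‖ ^ 2 : ℝ) : ℂ) • rankOne ℂ v v := by
    ext x
    simp only [rankOne_apply, inner_smul_left, smul_smul, _root_.smul_apply]
    congr 1
    rw [Complex.ofReal_pow, ← Complex.conj_mul']
    ring
  have h2 := norm_rankOne_self_sub_le u (c • v)
  have h3 : ‖rankOne ℂ (c • v) (c • v) - rankOne ℂ v v‖ = 1 - ‖c‖ ^ 2 := by
    rw [e, sub_smul_self, norm_smul, norm_rankOne, hv, ← Complex.ofReal_one,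
      ← Complex.ofReal_sub, Complex.norm_real, Real.norm_eq_abs, abs_sub_comm, abs_of_nonneg]
    · ring
    · nlinarith [norm_nonneg c]
  have h4 := norm_add_le (rankOne ℂ u u - rankOne ℂ (c • v) (c • v))
    (rankOne ℂ (c • v) (c • v) - rankOne ℂ v v)
  rw [sub_add_sub_cancel, h3] at h4
  rw [hu, hcv] at h2
  have := norm_nonneg (u - c • v)
  nlinarith [norm_nonneg c]

end GappedEigenvalue

/-! ### Real bilinear maps and smoothness of inverses. -/

section RealStructure

variable {K : Type*} [NormedAddCommGroup K] [InnerProductSpace ℂ K]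

/-- `(u, v) ↦ |u⟩⟨v|` as a real bilinear map. -/
noncomputable def rankOneBilin : K →L[ℝ] K →L[ℝ] (K →L[ℂ] K) :=
  LinearMap.mkContinuous₂
    (LinearMap.mk₂ ℝ (fun u v : K => (rankOne ℂ u v : K →L[ℂ] K)) (by simp)
      (fun c m n => by
        ext x
        simp [smul_comm c])
      (by simp) (fun c m n => by
        ext x
        change inner ℂ (c • n) x • m = c • (inner ℂ n x • m)
        rw [inner_smul_left_eq_smul, smul_assoc])) 1
    (fun x y => by simp)

/-- The inner product as a real bilinear map. -/
noncomputable def innerBilin : K →L[ℝ] K →L[ℝ] ℂ :=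
  (isBoundedBilinearMap_inner (𝕜 := ℂ) (E := K)).toContinuousLinearMap

/-- Evaluation of complex linear operators as a real bilinear map. -/
noncomputable def evalBilin : (K →L[ℂ] K) →L[ℝ] K →L[ℝ] K :=
  ContinuousLinearMap.restrictScalarsL ℂ K K ℝ ℝ

theorem evalBilin_apply (T : K →L[ℂ] K) (v : K) : evalBilin T v = T v := rfl

/-- Complex scalar multiplication as a real bilinear map. -/
noncomputable def smulBilin : ℂ →L[ℝ] K →L[ℝ] K := ContinuousLinearMap.lsmul ℝ ℂ

theorem smulBilin_apply (c : ℂ) (v : K) : smulBilin c v = c • v := rfl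

theorem contDiffOn_bilinear {F G W : Type*} [NormedAddCommGroup F] [NormedSpace ℝ F]
    [NormedAddCommGroup G] [NormedSpace ℝ G] [NormedAddCommGroup W] [NormedSpace ℝ W]
    (B : F →L[ℝ] G →L[ℝ] W) {n : WithTop ℕ∞} {f : ℝ → F} {g : ℝ → G} {s : Set ℝ}
    (hf : ContDiffOn ℝ n f s) (hg : ContDiffOn ℝ n g s) :
    ContDiffOn ℝ n (fun t => B (f t) (g t)) s :=
  B.isBoundedBilinearMap.contDiff.comp_contDiffOn (hf.prodMk hg)

theorem hasDerivWithinAt_bilinear {F G W : Type*} [NormedAddCommGroup F] [NormedSpace ℝ F]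
    [NormedAddCommGroup G] [NormedSpace ℝ G] [NormedAddCommGroup W] [NormedSpace ℝ W]
    (B : F →L[ℝ] G →L[ℝ] W) {f : ℝ → F} {g : ℝ → G} {f' : F} {g' : G} {s : Set ℝ} {t : ℝ}
    (hf : HasDerivWithinAt f f' s t) (hg : HasDerivWithinAt g g' s t) :
    HasDerivWithinAt (fun t => B (f t) (g t)) (B (f t) g' + B f' (g t)) s t := by
  simpa using (B.hasFDerivWithinAt_of_bilinear hf.hasFDerivWithinAt
    hg.hasFDerivWithinAt).hasDerivWithinAt

variable {H : ℝ → K →L[ℂ] K} {E : ℝ → ℂ} {φ : ℝ → K} {s : Set ℝ}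

theorem contDiffOn_bordered {n : WithTop ℕ∞} (hH : ContDiffOn ℝ n H s)
    (hE : ContDiffOn ℝ n E s) (hφ : ContDiffOn ℝ n φ s) :
    ContDiffOn ℝ n (fun t => bordered (H t) (E t) (φ t)) s :=
  (hH.sub (hE.smul contDiffOn_const)).add (contDiffOn_bilinear rankOneBilin hφ hφ)

theorem contDiffOn_ringInverse {A : Type*} [NormedRing A] [CompleteSpace A] [NormedAlgebra ℝ A]
    {n : WithTop ℕ∞} {f : ℝ → A} (hf : ContDiffOn ℝ n f s)
    (hu : ∀ t ∈ s, IsUnit (f t)) : ContDiffOn ℝ n (fun t => Ring.inverse (f t)) s := by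
  intro t ht
  obtain ⟨u, hu⟩ := hu t ht
  have := contDiffAt_ringInverse ℝ (n := n) u
  rw [hu] at this
  exact this.comp_contDiffWithinAt t (hf t ht)

end RealStructure

theorem tendsto_clm_apply {K X : Type*} [NormedAddCommGroup K] [NormedSpace ℂ K] {l : Filter X}
    {f : X → K →L[ℂ] K} {g : X → K} {a : K →L[ℂ] K} {b : K} (hf : Tendsto f l (𝓝 a))
    (hg : Tendsto g l (𝓝 b)) : Tendsto (fun x => f x (g x)) l (𝓝 (a b)) :=
  (isBoundedBilinearMap_apply.continuous.tendsto (a, b)).comp (hf.prodMk_nhds hg)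

/-! ### Regularity of the spectral projection and of the energy. -/

namespace IsGappedLevel

variable {K : Type*} [NormedAddCommGroup K] [InnerProductSpace ℂ K] [CompleteSpace K]
  {H : ℝ → K →L[ℂ] K} {E : ℝ → ℝ} {φ : ℝ → K}

theorem isUnit_bordered (level : IsGappedLevel H E φ)
    (hsym : ∀ s ∈ Icc (0 : ℝ) 1, (H s).toLinearMap.IsSymmetric) {s : ℝ}
    (hs : s ∈ Icc (0 : ℝ) 1) : IsUnit (bordered (H s) (E s) (φ s)) := by
  obtain ⟨g, hg, hgap⟩ := level.gap
  exact AdiabaticBoundary.isUnit_bordered (hsym s hs) (level.norm_eq_one s hs) (level.eigen s hs)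
    (level.nondegenerate s hs) hg (hgap s hs)

/-- Comes from `(H s - E s) φ t = (H s - H t + E t - E s) φ t`. The right side is small for `t` near
`s` whatever the phase of `φ t`. -/
theorem sub_inner_smul_eq (level : IsGappedLevel H E φ)
    (hsym : ∀ s ∈ Icc (0 : ℝ) 1, (H s).toLinearMap.IsSymmetric) {s t : ℝ}
    (hs : s ∈ Icc (0 : ℝ) 1) (ht : t ∈ Icc (0 : ℝ) 1) :
    φ t - inner ℂ (φ s) (φ t) • φ s = Ring.inverse (bordered (H s) (E s) (φ s))
      ((H s - H t + ((E t : ℂ) - E s) • (1 : K →L[ℂ] K)) (φ t)) := by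
  rw [← inverse_bordered_sub (level.norm_eq_one s hs) (level.eigen s hs)
    (level.isUnit_bordered hsym hs)]
  congr 1
  simp [level.eigen t ht, sub_smul]

theorem continuousOn_projection (level : IsGappedLevel H E φ)
    (hsym : ∀ s ∈ Icc (0 : ℝ) 1, (H s).toLinearMap.IsSymmetric)
    (hH : ContinuousOn H (Icc 0 1)) :
    ContinuousOn (fun t => rankOne ℂ (φ t) (φ t)) (Icc 0 1) := by
  intro s hs
  refine tendsto_iff_norm_sub_tendsto_zero.2 ?_
  let Γ := Ring.inverse (bordered (H s) (E s) (φ s))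
  let D : ℝ → K →L[ℂ] K := fun t => H s - H t + ((E t : ℂ) - E s) • (1 : K →L[ℂ] K)
  have hE : ContinuousOn (fun t => (E t : ℂ)) (Icc 0 1) :=
    Complex.continuous_ofReal.comp_continuousOn level.continuousOn_energy
  have hD : ContinuousWithinAt D (Icc 0 1) s :=
    (continuousWithinAt_const.sub (hH s hs)).add
      (((hE s hs).sub continuousWithinAt_const).smul continuousWithinAt_const)
  have hlim : Tendsto (fun t => 4 * (‖Γ‖ * ‖D t‖)) (𝓝[Icc 0 1] s) (𝓝 0) := by
    have : Tendsto (fun t => 4 * (‖Γ‖ * ‖D t‖)) (𝓝[Icc 0 1] s) (𝓝 (4 * (‖Γ‖ * ‖D s‖))) :=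
      (hD.norm.const_mul _).const_mul _
    simpa [D] using this
  refine squeeze_zero' (Eventually.of_forall fun _ => norm_nonneg _) ?_ hlim
  filter_upwards [self_mem_nhdsWithin] with t ht
  refine (norm_rankOne_self_sub_le_of_unit (level.norm_eq_one t ht)
    (level.norm_eq_one s hs)).trans ?_
  rw [level.sub_inner_smul_eq hsym hs ht]
  gcongr
  refine Γ.le_of_opNorm_le_of_le le_rfl ?_
  exact (D t).le_of_opNorm_le_of_le le_rfl (level.norm_eq_one t ht).le |>.trans_eq (mul_one _)

theorem continuousWithinAt_overlap (level : IsGappedLevel H E φ)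
    (hsym : ∀ s ∈ Icc (0 : ℝ) 1, (H s).toLinearMap.IsSymmetric)
    (hH : ContinuousOn H (Icc 0 1)) {s : ℝ} (hs : s ∈ Icc (0 : ℝ) 1) :
    Tendsto (fun t => inner ℂ (φ s) (rankOne ℂ (φ t) (φ t) (φ s))) (𝓝[Icc 0 1] s) (𝓝 1) := by
  have h := ((level.continuousOn_projection hsym hH s hs).clm_apply
    (continuousWithinAt_const (b := φ s)))
  have h2 := (continuousWithinAt_const (b := φ s)).inner (𝕜 := ℂ) h
  have : inner ℂ (φ s) (rankOne ℂ (φ s) (φ s) (φ s)) = (1 : ℂ) := by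
    rw [rankOne_apply, inner_self_eq_one (level.norm_eq_one s hs), one_smul,
      inner_self_eq_one (level.norm_eq_one s hs)]
  rw [← this]
  exact h2

/-- The vector `φ` may jump in phase, so only its projection `P` is usable. Near `s` the expectation
equals `⟪φ s, P A P φ s⟫ / ⟪φ s, P φ s⟫`. -/
theorem continuousOn_expectation (level : IsGappedLevel H E φ)
    (hsym : ∀ s ∈ Icc (0 : ℝ) 1, (H s).toLinearMap.IsSymmetric)
    (hH : ContinuousOn H (Icc 0 1)) {A : ℝ → K →L[ℂ] K} (hA : ContinuousOn A (Icc 0 1)) :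
    ContinuousOn (fun t => inner ℂ (φ t) (A t (φ t))) (Icc 0 1) := by
  intro s hs
  have hP := level.continuousOn_projection hsym hH s hs
  have hov := level.continuousWithinAt_overlap hsym hH hs
  have hv := hP.clm_apply (continuousWithinAt_const (b := φ s))
  have hnum := (continuousWithinAt_const (b := φ s)).inner (𝕜 := ℂ)
    (hP.clm_apply ((hA s hs).clm_apply hv))
  have hquot := hnum.tendsto.div hov one_ne_zero
  have hself : inner ℂ (φ s) (rankOne ℂ (φ s) (φ s) (A s (rankOne ℂ (φ s) (φ s) (φ s)))) / 1
      = inner ℂ (φ s) (A s (φ s)) := by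
    simp [level.norm_eq_one s hs]
  rw [hself] at hquot
  refine hquot.congr' ?_
  filter_upwards [hov.eventually_ne one_ne_zero] with t ht
  simp only [Pi.div_apply]
  rw [div_eq_iff ht]
  simp only [rankOne_apply, map_smul, inner_smul_right]
  ring

/-- Hellmann–Feynman without differentiating the eigenvector: `⟪φ s, (H t - H s) P φ s⟫ = (E t - E
s) ⟪φ s, P φ s⟫`, where `P` is the projection at `t`. -/
theorem hasDerivWithinAt_energy (level : IsGappedLevel H E φ)
    (hsym : ∀ s ∈ Icc (0 : ℝ) 1, (H s).toLinearMap.IsSymmetric)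
    (hH : ContinuousOn H (Icc 0 1)) {s : ℝ} (hs : s ∈ Icc (0 : ℝ) 1) {H' : K →L[ℂ] K}
    (hd : HasDerivWithinAt H H' (Icc 0 1) s) :
    HasDerivWithinAt (fun t => (E t : ℂ)) (inner ℂ (φ s) (H' (φ s))) (Icc 0 1) s := by
  rw [hasDerivWithinAt_iff_tendsto_slope] at hd ⊢
  have hle : 𝓝[Icc 0 1 \ {s}] s ≤ 𝓝[Icc 0 1] s := nhdsWithin_mono _ sdiff_subset
  have hov := (level.continuousWithinAt_overlap hsym hH hs).mono_left hle
  have hP := (level.continuousOn_projection hsym hH s hs).tendsto.mono_left hle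
  have hv := tendsto_clm_apply hP (tendsto_const_nhds (x := φ s))
  have hnum := (tendsto_const_nhds (x := φ s)).inner (𝕜 := ℂ) (tendsto_clm_apply hd hv)
  have hquot := hnum.div hov one_ne_zero
  have hself : inner ℂ (φ s) (H' (rankOne ℂ (φ s) (φ s) (φ s))) / 1
      = inner ℂ (φ s) (H' (φ s)) := by
    simp [level.norm_eq_one s hs]
  rw [hself] at hquot
  refine hquot.congr' ?_
  filter_upwards [hov.eventually_ne one_ne_zero, self_mem_nhdsWithin] with t ht htI
  simp only [Pi.div_apply]
  rw [div_eq_iff ht]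
  have hst : inner ℂ (φ s) (H s (φ t)) = (E s : ℂ) * inner ℂ (φ s) (φ t) := by
    have h := inner_sub_smul_eq_zero (hsym s hs) (level.eigen s hs) (φ t)
    rw [inner_sub_right, inner_smul_right] at h
    exact sub_eq_zero.1 h
  simp only [slope, vsub_eq_sub, rankOne_apply, map_smul, inner_smul_right, _root_.smul_apply,
    _root_.sub_apply, level.eigen t htI.1, Complex.real_smul]
  rw [← Complex.coe_smul, inner_smul_right, inner_sub_right, inner_smul_right, hst]
  ring

end IsGappedLevel

section Endpoint

variable {F : Type*} [NormedAddCommGroup F] [NormedSpace ℝ F]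

theorem hasDerivWithinAt_Ici_of_unitInterval {f : ℝ → F} {f' : F} {s : ℝ}
    (h : HasDerivWithinAt f f' (Icc 0 1) s) (hs : s ∈ Ico (0 : ℝ) 1) :
    HasDerivWithinAt f f' (Ici s) s :=
  h.mono_of_mem_nhdsWithin (Icc_mem_nhdsGE_of_mem hs)

end Endpoint

/-! ### Parallel transport of the eigenvector. -/

namespace IsGappedLevel

variable {K : Type*} [NormedAddCommGroup K] [InnerProductSpace ℂ K]
  {H : ℝ → K →L[ℂ] K} {E : ℝ → ℝ} {φ : ℝ → K}

theorem congr_phase (level : IsGappedLevel H E φ) {y : ℝ → K}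
    (hy : ∀ s ∈ Icc (0 : ℝ) 1, ‖y s‖ = 1) (h : ∀ s ∈ Icc (0 : ℝ) 1, ∃ c : ℂ, y s = c • φ s) :
    IsGappedLevel H E y where
  continuousOn_energy := level.continuousOn_energy
  norm_eq_one := hy
  eigen s hs := by
    obtain ⟨c, hc⟩ := h s hs
    rw [hc, map_smul, level.eigen s hs, smul_comm]
  nondegenerate s hs v hv := by
    obtain ⟨c, hc⟩ := h s hs
    obtain ⟨d, hd⟩ := level.nondegenerate s hs v hv
    have hc0 : c ≠ 0 := by
      rintro rfl
      have := hy s hs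
      simp [hc] at this
    exact ⟨d * c⁻¹, by rw [hd, hc, smul_smul, inv_mul_cancel_right₀ hc0]⟩
  gap := level.gap

theorem bordered_congr_phase {T : K →L[ℂ] K} {e c : ℂ} {u v : K} (hv : ‖v‖ = 1) (hu : ‖u‖ = 1)
    (h : u = c • v) : bordered T e u = bordered T e v := by
  have hc : ‖c‖ = 1 := by rwa [h, norm_smul, hv, mul_one] at hu
  rw [bordered, h, rankOne_smul_self_of_unit hc, bordered]

/-- The parallel transport of the eigenvector along a gapped level. -/
theorem exists_parallel_frame [CompleteSpace K] (level : IsGappedLevel H E φ)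
    (hsym : ∀ s ∈ Icc (0 : ℝ) 1, (H s).toLinearMap.IsSymmetric)
    (hH : ContDiffOn ℝ 1 H (Icc 0 1)) :
    ∃ y : ℝ → K, y 0 = φ 0 ∧ (∃ c : ℂ, y 1 = c • φ 1) ∧ IsGappedLevel H E y ∧
      ∀ s ∈ Icc (0 : ℝ) 1, HasDerivWithinAt y
        (Ring.inverse (bordered (H s) (E s) (y s))
          (inner ℂ (y s) (derivWithin H (Icc 0 1) s (y s)) • y s
            - derivWithin H (Icc 0 1) s (y s))) (Icc 0 1) s := by
  have h0 : (0 : ℝ) ∈ Icc (0 : ℝ) 1 := by simp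
  have h1 : (1 : ℝ) ∈ Icc (0 : ℝ) 1 := by simp
  let H' := derivWithin H (Icc 0 1)
  have hH' : ContinuousOn H' (Icc 0 1) := hH.continuousOn_derivWithin uniqueDiffOn_unitInterval
    le_rfl
  have hHd : ∀ s ∈ Icc (0 : ℝ) 1, HasDerivWithinAt H (H' s) (Icc 0 1) s := fun s hs =>
    (hH.differentiableOn one_ne_zero s hs).hasDerivWithinAt
  let e' : ℝ → ℂ := fun s => inner ℂ (φ s) (H' s (φ s))
  have he' : ContinuousOn e' (Icc 0 1) :=
    level.continuousOn_expectation hsym hH.continuousOn hH'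
  have hEd : ∀ s ∈ Icc (0 : ℝ) 1, HasDerivWithinAt (fun t => (E t : ℂ)) (e' s) (Icc 0 1) s :=
    fun s hs => level.hasDerivWithinAt_energy hsym hH.continuousOn hs (hHd s hs)
  let Γ : ℝ → K →L[ℂ] K := fun s => Ring.inverse (bordered (H s) (E s) (φ s))
  have hG : ∀ s ∈ Icc (0 : ℝ) 1, IsUnit (bordered (H s) (E s) (φ s)) := fun s hs =>
    level.isUnit_bordered hsym hs
  have hGc : ContinuousOn (fun s => bordered (H s) (E s) (φ s)) (Icc 0 1) :=
    (hH.continuousOn.sub ((Complex.continuous_ofReal.comp_continuousOn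
      level.continuousOn_energy).smul continuousOn_const)).add
      (level.continuousOn_projection hsym hH.continuousOn)
  have hΓ : ContinuousOn Γ (Icc 0 1) :=
    contDiffOn_zero.1 (contDiffOn_ringInverse (contDiffOn_zero.2 hGc) hG)
  let A : ℝ → K →L[ℂ] K := fun s => H' s - e' s • 1
  have hA : ContinuousOn A (Icc 0 1) := hH'.sub (he'.smul continuousOn_const)
  have hAφ : ∀ s ∈ Icc (0 : ℝ) 1, inner ℂ (φ s) (A s (φ s)) = 0 := fun s hs => by
    simp [A, e', level.norm_eq_one s hs]
  -- The coefficients involve `φ` only through its projection and `e'`, so they are continuous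
  -- although `φ` need not be.
  obtain ⟨y, hy0, hy⟩ := exists_linearODE_solution
    (M := fun s => (-(Γ s * A s)).restrictScalars ℝ)
    ((ContinuousLinearMap.restrictScalarsL ℂ K K ℝ ℝ).continuous.comp_continuousOn
      (hΓ.mul hA).neg) (φ 0)
  have hy' : ∀ s ∈ Icc (0 : ℝ) 1, HasDerivWithinAt y (-Γ s (A s (y s))) (Icc 0 1) s := hy
  -- The defect `z` of the eigenvalue equation solves a homogeneous linear equation with `z 0 = 0`,
  -- so it vanishes by Grönwall and `y` stays on the eigenline.
  let z : ℝ → K := fun s => H s (y s) - (E s : ℂ) • y s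
  have hz : ∀ s ∈ Icc (0 : ℝ) 1,
      HasDerivWithinAt z (inner ℂ (φ s) (A s (Γ s (z s))) • φ s) (Icc 0 1) s := by
    intro s hs
    have hd := (hasDerivWithinAt_bilinear evalBilin (hHd s hs) (hy' s hs)).sub
      (hasDerivWithinAt_bilinear smulBilin (hEd s hs) (hy' s hs))
    refine hd.congr_deriv ?_
    simp only [evalBilin_apply, smulBilin_apply]
    have e1 := sub_inverse_bordered (hsym s hs) (level.norm_eq_one s hs) (level.eigen s hs)
      (hG s hs) (A s (y s))
    have e2 := inverse_bordered_sub (level.norm_eq_one s hs) (level.eigen s hs) (hG s hs) (y s)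
    change Γ s (z s) = _ at e2
    have e3 : inner ℂ (φ s) (A s (Γ s (z s))) = inner ℂ (φ s) (A s (y s)) := by
      rw [e2, map_sub, map_smul, inner_sub_right, inner_smul_right, hAφ s hs, mul_zero, sub_zero]
    rw [e3]
    have e4 : H' s (y s) = A s (y s) + e' s • y s := (sub_add_cancel _ _).symm
    change H s (Γ s (A s (y s))) - (E s : ℂ) • Γ s (A s (y s)) = _ at e1
    rw [map_neg, sub_eq_iff_eq_add.1 e1, e4]
    module
  obtain ⟨C, hC⟩ := isCompact_Icc.exists_bound_of_continuousOn (hA.mul hΓ)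
  have hz0 : ∀ s ∈ Icc (0 : ℝ) 1, z s = 0 := by
    refine eq_zero_of_abs_deriv_le_mul_abs_self_of_eq_zero_right (K := C)
      (fun s hs => (hz s hs).continuousWithinAt)
      (fun s hs => hasDerivWithinAt_Ici_of_unitInterval (hz s ⟨hs.1, hs.2.le⟩) hs) ?_ ?_
    · simp [z, hy0, level.eigen 0 h0]
    · intro s hs
      have hs' : s ∈ Icc (0 : ℝ) 1 := ⟨hs.1, hs.2.le⟩
      rw [norm_smul, level.norm_eq_one s hs', mul_one]
      refine (norm_inner_le_norm _ _).trans ?_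
      rw [level.norm_eq_one s hs', one_mul]
      exact (A s * Γ s).le_of_opNorm_le (hC s hs') (z s)
  have hphase : ∀ s ∈ Icc (0 : ℝ) 1, ∃ c : ℂ, y s = c • φ s := fun s hs =>
    level.nondegenerate s hs _ (sub_eq_zero.1 (hz0 s hs))
  have horth : ∀ s ∈ Icc (0 : ℝ) 1, inner ℂ (y s) (-Γ s (A s (y s))) = 0 := by
    intro s hs
    obtain ⟨c, hc⟩ := hphase s hs
    rw [hc, inner_neg_right, inner_smul_left, inner_inverse_bordered (hsym s hs)
      (level.norm_eq_one s hs) (level.eigen s hs) (hG s hs), map_smul, inner_smul_right,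
      hAφ s hs, mul_zero, mul_zero, neg_zero]
  have hnorm : ∀ s ∈ Icc (0 : ℝ) 1, ‖y s‖ = 1 := by
    intro s hs
    have hd : ∀ t ∈ Icc (0 : ℝ) 1,
        HasDerivWithinAt (fun t => inner ℂ (y t) (y t)) 0 (Icc 0 1) t := fun t ht => by
      refine ((hy' t ht).inner ℂ (hy' t ht)).congr_deriv ?_
      rw [horth t ht, ← inner_conj_symm, horth t ht, map_zero, add_zero]
    have := constant_of_has_deriv_right_zero (fun t ht => (hd t ht).continuousWithinAt)
      (fun t ht => hasDerivWithinAt_Ici_of_unitInterval (hd t ⟨ht.1, ht.2.le⟩) ht) s hs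
    rw [hy0, inner_self_eq_one (level.norm_eq_one 0 h0), inner_self_eq_norm_sq_to_K] at this
    have h2 : ‖y s‖ ^ 2 = 1 := Complex.ofReal_injective (by simpa using this)
    exact (pow_eq_one_iff_of_nonneg (norm_nonneg _) two_ne_zero).1 h2
  refine ⟨y, hy0, hphase 1 h1, level.congr_phase hnorm hphase, fun s hs => ?_⟩
  refine (hy' s hs).congr_deriv ?_
  obtain ⟨c, hc⟩ := hphase s hs
  rw [bordered_congr_phase (level.norm_eq_one s hs) (hnorm s hs) hc, ← map_neg]
  congr 1
  have hcc : (starRingEnd ℂ) c * c = 1 := by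
    rw [Complex.conj_mul']
    have := hnorm s hs
    rw [hc, norm_smul, level.norm_eq_one s hs, mul_one] at this
    simp [this]
  have : inner ℂ (y s) (derivWithin H (Icc 0 1) s (y s)) = e' s := by
    rw [hc, map_smul, inner_smul_left, inner_smul_right, ← mul_assoc, hcc, one_mul]
  rw [this]
  simp [A, H']

end IsGappedLevel

/-! ### Smoothness and endpoint flatness of the transported eigenvector. -/

section Regularity

variable {F : Type*} [NormedAddCommGroup F] [NormedSpace ℝ F]

theorem contDiffOn_succ_of_hasDerivWithinAt {m : ℕ} {f f' : ℝ → F}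
    (h : ∀ s ∈ Icc (0 : ℝ) 1, HasDerivWithinAt f (f' s) (Icc 0 1) s)
    (hf' : ContDiffOn ℝ m f' (Icc 0 1)) : ContDiffOn ℝ (m + 1 : ℕ) f (Icc 0 1) := by
  rw [Nat.cast_succ, contDiffOn_succ_iff_derivWithin uniqueDiffOn_unitInterval]
  refine ⟨fun s hs => (h s hs).differentiableWithinAt, fun hm => by simp at hm, ?_⟩
  exact hf'.congr fun s hs => (h s hs).derivWithin (uniqueDiffOn_unitInterval s hs)

theorem contDiffOn_derivWithin_unitInterval {m : ℕ} {f : ℝ → F}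
    (hf : ContDiffOn ℝ (m + 1 : ℕ) f (Icc 0 1)) :
    ContDiffOn ℝ m (derivWithin f (Icc 0 1)) (Icc 0 1) :=
  hf.derivWithin uniqueDiffOn_unitInterval (by norm_cast)

theorem hasDerivWithinAt_of_contDiffOn_succ {m : ℕ} {f : ℝ → F}
    (hf : ContDiffOn ℝ (m + 1 : ℕ) f (Icc 0 1)) {s : ℝ} (hs : s ∈ Icc (0 : ℝ) 1) :
    HasDerivWithinAt f (derivWithin f (Icc 0 1) s) (Icc 0 1) s :=
  (hf.differentiableOn (by simp) s hs).hasDerivWithinAt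

theorem contDiffOn_of_nat_le {m n : ℕ} {f : ℝ → F} {s : Set ℝ} (hf : ContDiffOn ℝ n f s)
    (h : m ≤ n) : ContDiffOn ℝ m f s := hf.of_le (by exact_mod_cast h)

end Regularity

variable {K : Type*} [NormedAddCommGroup K] [InnerProductSpace ℂ K]
  {H : ℝ → K →L[ℂ] K} {E : ℝ → ℝ} {y : ℝ → K}

/-- Bootstrap: `y'` and `E'` are smooth expressions in `y`, `E`, `H` and `H'`, so each round gains
one derivative until that of `H'` is used up. -/
theorem IsGappedLevel.contDiffOn_frame [CompleteSpace K] (level : IsGappedLevel H E y)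
    (hsym : ∀ s ∈ Icc (0 : ℝ) 1, (H s).toLinearMap.IsSymmetric) {n : ℕ}
    (hH : ContDiffOn ℝ (n + 1 : ℕ) H (Icc 0 1))
    (hy : ∀ s ∈ Icc (0 : ℝ) 1, HasDerivWithinAt y
        (Ring.inverse (bordered (H s) (E s) (y s))
          (inner ℂ (y s) (derivWithin H (Icc 0 1) s (y s)) • y s
            - derivWithin H (Icc 0 1) s (y s))) (Icc 0 1) s) :
    ContDiffOn ℝ (n + 1 : ℕ) y (Icc 0 1) ∧
      ContDiffOn ℝ (n + 1 : ℕ) (fun s => (E s : ℂ)) (Icc 0 1) := by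
  suffices ∀ m ≤ n + 1, ContDiffOn ℝ m y (Icc 0 1) ∧
      ContDiffOn ℝ m (fun s => (E s : ℂ)) (Icc 0 1) from this _ le_rfl
  intro m
  induction m with
  | zero =>
    intro _
    rw [Nat.cast_zero, contDiffOn_zero, contDiffOn_zero]
    exact ⟨fun s hs => (hy s hs).continuousWithinAt,
      Complex.continuous_ofReal.comp_continuousOn level.continuousOn_energy⟩
  | succ m ih =>
    intro hm
    obtain ⟨hym, hEm⟩ := ih (by omega)
    have hH' : ContDiffOn ℝ m (derivWithin H (Icc 0 1)) (Icc 0 1) :=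
      contDiffOn_of_nat_le (contDiffOn_derivWithin_unitInterval hH) (by omega)
    have hH'y := contDiffOn_bilinear evalBilin hH' hym
    have he := hym.inner ℂ hH'y
    have hΓ := contDiffOn_ringInverse
      (contDiffOn_bordered (contDiffOn_of_nat_le hH (by omega : m ≤ n + 1)) hEm hym)
      (fun s hs => level.isUnit_bordered hsym hs)
    refine ⟨contDiffOn_succ_of_hasDerivWithinAt hy ?_,
      contDiffOn_succ_of_hasDerivWithinAt (fun s hs => level.hasDerivWithinAt_energy hsym
        hH.continuousOn hs (hasDerivWithinAt_of_contDiffOn_succ hH hs)) he⟩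
    exact contDiffOn_bilinear evalBilin hΓ
      ((contDiffOn_bilinear smulBilin he hym).sub hH'y)

/-- A parallel eigenvector `y` of `H`, with derivatives vanishing to order `k` at the endpoints,
together with a reduced resolvent `Γ`. -/
structure IsParallelFrame (k : ℕ) (H : ℝ → K →L[ℂ] K) (E : ℝ → ℝ) (y : ℝ → K)
    (Γ : ℝ → K →L[ℂ] K) : Prop where
  contDiffOn : ContDiffOn ℝ (k + 2 : ℕ) y (Icc 0 1)
  contDiffOn_resolvent : ContDiffOn ℝ (k + 2 : ℕ) Γ (Icc 0 1)
  norm_eq_one : ∀ s ∈ Icc (0 : ℝ) 1, ‖y s‖ = 1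
  eigen : ∀ s ∈ Icc (0 : ℝ) 1, H s (y s) = (E s : ℂ) • y s
  inner_deriv : ∀ s ∈ Icc (0 : ℝ) 1, inner ℂ (y s) (derivWithin y (Icc 0 1) s) = 0
  resolvent : ∀ s ∈ Icc (0 : ℝ) 1, ∀ x : K, inner ℂ (y s) x = 0 →
    H s (Γ s x) - (E s : ℂ) • Γ s x = x ∧ inner ℂ (y s) (Γ s x) = 0
  flat : FlatAtEnds k (derivWithin y (Icc 0 1))

theorem IsGappedLevel.isParallelFrame [CompleteSpace K] (level : IsGappedLevel H E y)
    (hsym : ∀ s ∈ Icc (0 : ℝ) 1, (H s).toLinearMap.IsSymmetric) {k : ℕ}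
    (hH : ContDiffOn ℝ (k + 2 : ℕ) H (Icc 0 1))
    (hflat : FlatAtEnds k (derivWithin H (Icc 0 1)))
    (hy : ∀ s ∈ Icc (0 : ℝ) 1, HasDerivWithinAt y
        (Ring.inverse (bordered (H s) (E s) (y s))
          (inner ℂ (y s) (derivWithin H (Icc 0 1) s (y s)) • y s
            - derivWithin H (Icc 0 1) s (y s))) (Icc 0 1) s) :
    IsParallelFrame k H E y fun s => Ring.inverse (bordered (H s) (E s) (y s)) := by
  obtain ⟨hyc, hEc⟩ := level.contDiffOn_frame hsym hH hy
  have hG : ∀ s ∈ Icc (0 : ℝ) 1, IsUnit (bordered (H s) (E s) (y s)) := fun s hs =>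
    level.isUnit_bordered hsym hs
  have hΓ := contDiffOn_ringInverse (contDiffOn_bordered hH hEc hyc) hG
  have hyd : ∀ s ∈ Icc (0 : ℝ) 1, derivWithin y (Icc 0 1) s =
      Ring.inverse (bordered (H s) (E s) (y s))
          (inner ℂ (y s) (derivWithin H (Icc 0 1) s (y s)) • y s
            - derivWithin H (Icc 0 1) s (y s)) := fun s hs =>
    (hy s hs).derivWithin (uniqueDiffOn_unitInterval s hs)
  refine ⟨hyc, hΓ, level.norm_eq_one, level.eigen, fun s hs => ?_, fun s hs x hx => ⟨?_, ?_⟩, ?_⟩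
  · rw [hyd s hs, inner_inverse_bordered (hsym s hs) (level.norm_eq_one s hs)
      (level.eigen s hs) (hG s hs), inner_sub_right, inner_smul_right,
      inner_self_eq_one (level.norm_eq_one s hs), mul_one, sub_self]
  · rw [sub_inverse_bordered (hsym s hs) (level.norm_eq_one s hs)
      (level.eigen s hs) (hG s hs), hx, zero_smul, sub_zero]
  · rw [inner_inverse_bordered (hsym s hs) (level.norm_eq_one s hs)
      (level.eigen s hs) (hG s hs), hx]
  · have hH'c := contDiffOn_derivWithin_unitInterval hH
    have hyc' := contDiffOn_of_nat_le hyc (by omega : k + 1 ≤ k + 2)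
    have hΓ' := contDiffOn_of_nat_le hΓ (by omega : k + 1 ≤ k + 2)
    -- Build `y' = Γ (⟪y, H' y⟫ y - H' y)` factor by factor; each term contains `H'`, whose flatness
    -- propagates.
    have h1 := hflat.bilinear evalBilin.flip hyc' hH'c (by omega)
    have h1c := contDiffOn_bilinear evalBilin.flip hyc' hH'c
    have h2 := h1.bilinear innerBilin hyc' h1c (by omega)
    have h2c := contDiffOn_bilinear innerBilin hyc' h1c
    have h3 := h2.bilinear smulBilin.flip hyc' h2c (by omega)
    have h3c := contDiffOn_bilinear smulBilin.flip hyc' h2c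
    have h4 := h1.clm_comp (-ContinuousLinearMap.id ℝ K) h1c (by omega)
    have h5 := h3.add h4 h3c h1c.neg (by omega)
    have h6 := h5.bilinear evalBilin hΓ' (h3c.add h1c.neg) (by omega)
    refine h6.congr fun s hs => ?_
    rw [hyd s hs, sub_eq_add_neg]
    rfl

/-! ### The adiabatic expansion in powers of `1/τ`. -/

namespace IsParallelFrame

variable {k : ℕ} {Γ : ℝ → K →L[ℂ] K}

/-- One order of the adiabatic expansion. -/
theorem exists_next_order (fr : IsParallelFrame k H E y Γ) {p : ℕ} (hp : p ≤ k) {χ : ℝ → K}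
    (hχ : ContDiffOn ℝ (p + 2 : ℕ) χ (Icc 0 1))
    (horth : ∀ s ∈ Icc (0 : ℝ) 1, inner ℂ (y s) (derivWithin χ (Icc 0 1) s) = 0)
    (hflat : FlatAtEnds p (derivWithin χ (Icc 0 1))) :
    ∃ (a : ℝ → ℂ) (w : ℝ → K), a 0 = 0 ∧ FlatAtEnds p w ∧
      ContDiffOn ℝ (p + 1 : ℕ) (fun s => a s • y s + w s) (Icc 0 1) ∧
      (∀ s ∈ Icc (0 : ℝ) 1, H s (a s • y s + w s) - (E s : ℂ) • (a s • y s + w s)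
        = Complex.I • derivWithin χ (Icc 0 1) s) ∧
      (∀ s ∈ Icc (0 : ℝ) 1,
        inner ℂ (y s) (derivWithin (fun s => a s • y s + w s) (Icc 0 1) s) = 0) ∧
      FlatAtEnds (p - 1) (derivWithin (fun s => a s • y s + w s) (Icc 0 1)) := by
  set χ' := derivWithin χ (Icc 0 1) with hχ'
  set y' := derivWithin y (Icc 0 1) with hy'
  have hχc : ContDiffOn ℝ (p + 1 : ℕ) χ' (Icc 0 1) := contDiffOn_derivWithin_unitInterval hχ
  have hyc := contDiffOn_of_nat_le fr.contDiffOn (by omega : p + 1 ≤ k + 2)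
  have hy'c : ContDiffOn ℝ (p + 1 : ℕ) y' (Icc 0 1) :=
    contDiffOn_of_nat_le (contDiffOn_derivWithin_unitInterval fr.contDiffOn) (by omega)
  have hΓc := contDiffOn_of_nat_le fr.contDiffOn_resolvent (by omega : p + 1 ≤ k + 2)
  let w : ℝ → K := fun s => Γ s (Complex.I • χ' s)
  have hIχc : ContDiffOn ℝ (p + 1 : ℕ) (fun s => Complex.I • χ' s) (Icc 0 1) :=
    contDiffOn_const.smul hχc
  have hwc : ContDiffOn ℝ (p + 1 : ℕ) w (Icc 0 1) := contDiffOn_bilinear evalBilin hΓc hIχc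
  have hwf : FlatAtEnds p w := (hflat.clm_comp (smulBilin Complex.I) hχc (by omega)).bilinear
    evalBilin hΓc hIχc (by omega)
  have hIχ : ∀ s ∈ Icc (0 : ℝ) 1, inner ℂ (y s) (Complex.I • χ' s) = 0 := fun s hs => by
    rw [inner_smul_right, horth s hs, mul_zero]
  have hyw : ∀ s ∈ Icc (0 : ℝ) 1, inner ℂ (y s) (w s) = 0 := fun s hs =>
    (fr.resolvent s hs _ (hIχ s hs)).2
  have ha'c : ContDiffOn ℝ (p + 1 : ℕ) (fun s => inner ℂ (y' s) (w s)) (Icc 0 1) :=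
    hy'c.inner ℂ hwc
  have ha'f : FlatAtEnds p (fun s => inner ℂ (y' s) (w s)) :=
    hwf.bilinear innerBilin hy'c hwc (by omega)
  -- Differentiating `⟪y, w⟫ = 0` gives `⟪y, w'⟫ = -⟪y', w⟫`, so `a' = ⟪y', w⟫` makes the derivative
  -- of `a y + w` orthogonal to `y`, as the next order requires.
  obtain ⟨a, ha0, ha⟩ := exists_antideriv_unitInterval ha'c.continuousOn
  have hac : ContDiffOn ℝ (p + 1 : ℕ) a (Icc 0 1) :=
    contDiffOn_succ_of_hasDerivWithinAt ha (contDiffOn_of_nat_le ha'c (by omega))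
  have hyd : ∀ s ∈ Icc (0 : ℝ) 1, HasDerivWithinAt y (y' s) (Icc 0 1) s := fun s hs =>
    hasDerivWithinAt_of_contDiffOn_succ hyc hs
  have hwd : ∀ s ∈ Icc (0 : ℝ) 1, HasDerivWithinAt w (derivWithin w (Icc 0 1) s) (Icc 0 1) s :=
    fun s hs => hasDerivWithinAt_of_contDiffOn_succ hwc hs
  have hd : EqOn (derivWithin (fun s => a s • y s + w s) (Icc 0 1))
      (fun s => (a s • y' s + inner ℂ (y' s) (w s) • y s) + derivWithin w (Icc 0 1) s)
      (Icc 0 1) := fun s hs =>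
    ((hasDerivWithinAt_bilinear smulBilin (ha s hs) (hyd s hs)).add (hwd s hs)).derivWithin
      (uniqueDiffOn_unitInterval s hs)
  refine ⟨a, w, ha0, hwf, (contDiffOn_bilinear smulBilin hac hyc).add hwc, fun s hs => ?_,
    fun s hs => ?_, ?_⟩
  · rw [← (fr.resolvent s hs _ (hIχ s hs)).1, map_add, map_smul, fr.eigen s hs]
    module
  · have h0 : inner ℂ (y s) (derivWithin w (Icc 0 1) s) + inner ℂ (y' s) (w s) = 0 := by
      have h1 := (hyd s hs).inner ℂ (hwd s hs)
      have h2 := (hasDerivWithinAt_const s (Icc (0 : ℝ) 1) (0 : ℂ)).congr hyw (hyw s hs)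
      exact (uniqueDiffOn_unitInterval s hs).eq_deriv _ h1 h2
    rw [hd hs]
    simp only
    rw [inner_add_right, inner_add_right, inner_smul_right, inner_smul_right,
      fr.inner_deriv s hs, inner_self_eq_one (fr.norm_eq_one s hs), mul_zero, zero_add, mul_one,
      add_comm]
    exact h0
  · have hw'c := contDiffOn_derivWithin_unitInterval hwc
    have hpp : p ≤ p + 1 := by omega
    have h1 : FlatAtEnds p (fun s => a s • y' s) :=
      (fr.flat.mono hp).bilinear smulBilin hac hy'c (by omega)
    have h1c := contDiffOn_of_nat_le (contDiffOn_bilinear smulBilin hac hy'c) hpp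
    have h2 : FlatAtEnds p (fun s => inner ℂ (y' s) (w s) • y s) :=
      ha'f.bilinear smulBilin.flip hyc ha'c (by omega)
    have h2c := contDiffOn_of_nat_le (contDiffOn_bilinear smulBilin ha'c hyc) hpp
    exact (((h1.add h2 h1c h2c (by omega)).mono (by omega)).add hwf.derivWithin
      (h1c.add h2c) hw'c (by omega)).congr hd

/-- The Hamiltonian term of the correction equals the old residual, since `-iτ · τ⁻⁽ʲ⁺¹⁾ · i = τ⁻ʲ`.
What remains is one order smaller. -/
theorem hasDerivWithinAt_add_correction {T : K →L[ℂ] K} {e : ℂ} {τ s : ℝ} (hτ : τ ≠ 0) {j : ℕ}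
    {Φ u : ℝ → K} {u' v : K} {I : Set ℝ}
    (hΦ : HasDerivWithinAt Φ (-(Complex.I * (τ : ℂ)) • (T (Φ s) - e • Φ s)
      + ((τ : ℂ) ^ j)⁻¹ • v) I s)
    (hu : HasDerivWithinAt u u' I s) (heq : T (u s) - e • u s = Complex.I • v) :
    HasDerivWithinAt (fun s => Φ s + ((τ : ℂ) ^ (j + 1))⁻¹ • u s)
      (-(Complex.I * (τ : ℂ)) • (T (Φ s + ((τ : ℂ) ^ (j + 1))⁻¹ • u s)
        - e • (Φ s + ((τ : ℂ) ^ (j + 1))⁻¹ • u s)) + ((τ : ℂ) ^ (j + 1))⁻¹ • u') I s := by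
  refine (hΦ.add (hu.const_smul ((τ : ℂ) ^ (j + 1))⁻¹)).congr_deriv ?_
  have hτ' : (τ : ℂ) ≠ 0 := by exact_mod_cast hτ
  have h : (-(Complex.I * (τ : ℂ)) * ((τ : ℂ) ^ (j + 1))⁻¹) * Complex.I = ((τ : ℂ) ^ j)⁻¹ := by
    rw [pow_succ]
    field_simp
    simp
  rw [← h, mul_smul, ← heq, map_add, map_smul]
  module

/-- The adiabatic expansion up to order `j ≤ k`; the correction terms vanish at the endpoints. -/
theorem exists_expansion (fr : IsParallelFrame k H E y Γ) :
    ∀ j p : ℕ, j + p = k → ∃ (Φ : ℝ → ℝ → K) (χ : ℝ → K),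
      ContDiffOn ℝ (p + 2 : ℕ) χ (Icc 0 1) ∧
      (∀ s ∈ Icc (0 : ℝ) 1, inner ℂ (y s) (derivWithin χ (Icc 0 1) s) = 0) ∧
      FlatAtEnds p (derivWithin χ (Icc 0 1)) ∧
      ∀ τ : ℝ, 0 < τ → (∀ s ∈ Icc (0 : ℝ) 1, HasDerivWithinAt (Φ τ)
          (-(Complex.I * (τ : ℂ)) • (H s (Φ τ s) - (E s : ℂ) • Φ τ s)
            + ((τ : ℂ) ^ j)⁻¹ • derivWithin χ (Icc 0 1) s) (Icc 0 1) s) ∧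
        Φ τ 0 = y 0 ∧ ∃ c : ℂ, Φ τ 1 = c • y 1 := by
  intro j
  induction j with
  | zero =>
    intro p hp
    obtain rfl : p = k := by omega
    refine ⟨fun _ => y, y, fr.contDiffOn, fr.inner_deriv, fr.flat, fun τ _ =>
      ⟨fun s hs => ?_, rfl, 1, (one_smul _ _).symm⟩⟩
    refine (hasDerivWithinAt_of_contDiffOn_succ fr.contDiffOn hs).congr_deriv ?_
    simp [fr.eigen s hs]
  | succ j ih =>
    intro p hp
    obtain ⟨Φ, χ, hχ, horth, hflat, hΦ⟩ := ih (p + 1) (by omega)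
    obtain ⟨a, w, ha0, hwf, hc, heq, horth₂, hflat₂⟩ :=
      fr.exists_next_order (by omega) hχ horth hflat
    refine ⟨fun τ s => Φ τ s + ((τ : ℂ) ^ (j + 1))⁻¹ • (a s • y s + w s),
      fun s => a s • y s + w s, hc, horth₂, hflat₂, fun τ hτ => ?_⟩
    obtain ⟨hd, h0, c, h1⟩ := hΦ τ hτ
    refine ⟨fun s hs => ?_, ?_, c + ((τ : ℂ) ^ (j + 1))⁻¹ * a 1, ?_⟩
    · exact hasDerivWithinAt_add_correction hτ.ne' (hd s hs)
        (hasDerivWithinAt_of_contDiffOn_succ hc hs) (heq s hs)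
    · simp [h0, ha0, hwf.eq_zero (Nat.succ_pos p) (x := 0) (by simp)]
    · simp only [h1, hwf.eq_zero (Nat.succ_pos p) (x := 1) (by simp), add_zero]
      module

/-- An approximate solution in the frame rotating with the dynamical phase, of order `k + 1`. -/
theorem exists_approximate_solution (fr : IsParallelFrame k H E y Γ) :
    ∃ (C : ℝ) (Φ r : ℝ → ℝ → K), ∀ τ : ℝ, 0 < τ →
      (∀ s ∈ Icc (0 : ℝ) 1, HasDerivWithinAt (Φ τ)
          (-(Complex.I * (τ : ℂ)) • (H s (Φ τ s) - (E s : ℂ) • Φ τ s) + r τ s) (Icc 0 1) s) ∧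
      (∀ s ∈ Icc (0 : ℝ) 1, ‖r τ s‖ ≤ C / τ ^ (k + 1)) ∧
      ‖Φ τ 0 - y 0‖ ≤ C / τ ^ (k + 1) ∧ ∃ c : ℂ, ‖Φ τ 1 - c • y 1‖ ≤ C / τ ^ (k + 1) := by
  obtain ⟨Φ, χ, hχ, horth, hflat, hΦ⟩ := fr.exists_expansion k 0 (by omega)
  -- Flatness is exhausted (`p = 0`), so this last `w` need not vanish at the endpoints; `‖w 0‖` and
  -- `‖w 1‖` enter the constant.
  obtain ⟨a, w, ha0, -, hc, heq, -, -⟩ := fr.exists_next_order (by omega) hχ horth hflat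
  obtain ⟨M, hM⟩ := isCompact_Icc.exists_bound_of_continuousOn
    (contDiffOn_derivWithin_unitInterval hc).continuousOn
  refine ⟨max M (max ‖w 0‖ ‖w 1‖), fun τ s => Φ τ s + ((τ : ℂ) ^ (k + 1))⁻¹ • (a s • y s + w s),
    fun τ s => ((τ : ℂ) ^ (k + 1))⁻¹ • derivWithin (fun s => a s • y s + w s) (Icc 0 1) s,
    fun τ hτ => ?_⟩
  obtain ⟨hd, h0, c, h1⟩ := hΦ τ hτ
  have hnorm : ∀ (x : K) (B : ℝ), ‖x‖ ≤ B → ‖((τ : ℂ) ^ (k + 1))⁻¹ • x‖ ≤ B / τ ^ (k + 1) := by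
    intro x B hx
    rw [norm_smul, norm_inv, norm_pow, Complex.norm_real, Real.norm_of_nonneg hτ.le,
      ← div_eq_inv_mul]
    gcongr
  refine ⟨fun s hs => ?_, fun s hs => hnorm _ _ ((hM s hs).trans (le_max_left _ _)), ?_,
    c + ((τ : ℂ) ^ (k + 1))⁻¹ * a 1, ?_⟩
  · exact hasDerivWithinAt_add_correction hτ.ne' (hd s hs)
      (hasDerivWithinAt_of_contDiffOn_succ hc hs) (heq s hs)
  · have : Φ τ 0 + ((τ : ℂ) ^ (k + 1))⁻¹ • (a 0 • y 0 + w 0) - y 0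
        = ((τ : ℂ) ^ (k + 1))⁻¹ • w 0 := by rw [h0, ha0]; module
    rw [this]
    exact hnorm _ _ ((le_max_left _ _).trans (le_max_right _ _))
  · have : Φ τ 1 + ((τ : ℂ) ^ (k + 1))⁻¹ • (a 1 • y 1 + w 1)
        - (c + ((τ : ℂ) ^ (k + 1))⁻¹ * a 1) • y 1 = ((τ : ℂ) ^ (k + 1))⁻¹ • w 1 := by
      rw [h1]; module
    rw [this]
    exact hnorm _ _ ((le_max_right _ _).trans (le_max_right _ _))

end IsParallelFrame

/-! ### From the approximate solution to the true one. -/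

section AdiabaticTheorem

variable {K : Type*} [NormedAddCommGroup K] [InnerProductSpace ℂ K]

theorem exists_unit_phase_of_norm_sub_le {u v : K} {c : ℂ} {δ : ℝ} (hu : ‖u‖ = 1) (hv : ‖v‖ = 1)
    (h : ‖u - c • v‖ ≤ δ) : ∃ z : ℂ, ‖z‖ = 1 ∧ ‖u - z • v‖ ≤ 2 * δ := by
  obtain ⟨z, hz, hcz⟩ : ∃ z : ℂ, ‖z‖ = 1 ∧ ‖c - z‖ = |1 - ‖c‖| := by
    by_cases hc : c = 0
    · exact ⟨1, by simp, by simp [hc]⟩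
    · have hc' : (‖c‖ : ℂ) ≠ 0 := by simpa using hc
      refine ⟨c / ‖c‖, by simp [hc], ?_⟩
      have : c - c / ‖c‖ = (c / ‖c‖) * ((‖c‖ - 1 : ℝ) : ℂ) := by
        push_cast
        field_simp
      rw [this, norm_mul, Complex.norm_real, Real.norm_eq_abs, abs_sub_comm]
      simp [hc]
  refine ⟨z, hz, ?_⟩
  have h1 : |1 - ‖c‖| ≤ δ := by
    have := abs_norm_sub_norm_le u (c • v)
    rw [hu, norm_smul, hv, mul_one] at this
    exact this.trans h
  have h2 : u - z • v = (u - c • v) + (c - z) • v := by module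
  rw [h2]
  refine (norm_add_le _ _).trans ?_
  rw [norm_smul, hcz, hv, mul_one]
  linarith

/-- The adiabatic theorem with boundary cancellation. -/
theorem exists_adiabatic_bound [CompleteSpace K] {k : ℕ} {H : ℝ → K →L[ℂ] K} {E : ℝ → ℝ}
    {φ : ℝ → K} (level : IsGappedLevel H E φ)
    (hsym : ∀ s ∈ Icc (0 : ℝ) 1, (H s).toLinearMap.IsSymmetric)
    (hH : ContDiffOn ℝ (k + 2 : ℕ) H (Icc 0 1))
    (hflat : FlatAtEnds k (derivWithin H (Icc 0 1))) :
    ∃ C : ℝ, ∀ τ : ℝ, 0 < τ → ∀ ψ : ℝ → K, IsSchrodingerSolution H τ ψ → ψ 0 = φ 0 →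
      ‖ψ 1‖ = 1 ∧ ∃ z : ℂ, ‖z‖ = 1 ∧ ‖ψ 1 - z • φ 1‖ ≤ C / τ ^ (k + 1) := by
  have h0 : (0 : ℝ) ∈ Icc (0 : ℝ) 1 := by simp
  have h1 : (1 : ℝ) ∈ Icc (0 : ℝ) 1 := by simp
  obtain ⟨y, hy0, ⟨c₁, hy1⟩, hlevel, hy⟩ := level.exists_parallel_frame hsym
    (hH.of_le (by norm_cast; omega))
  obtain ⟨C, Φ, r, hΦ⟩ := (hlevel.isParallelFrame hsym hH hflat hy).exists_approximate_solution
  obtain ⟨θ, hθ0, hθ⟩ := exists_antideriv_unitInterval level.continuousOn_energy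
  -- Three errors of size `δ` add up: initial mismatch, residual and final mismatch. Normalising the
  -- phase factor to modulus one doubles the sum.
  refine ⟨2 * (3 * C), fun τ hτ ψ hψ hψ0 => ?_⟩
  obtain ⟨hd, hr, hi, c, hf⟩ := hΦ τ hτ
  set δ := C / τ ^ (k + 1) with hδ
  have hψ1 : ‖ψ 1‖ = 1 := by
    have hle : ‖ψ 1‖ ≤ ‖ψ 0‖ + 0 := norm_le_add_of_hasDerivWithinAt (r := fun _ => 0) hsym
      (fun s hs => by simpa using hψ s hs) (by simp)
    -- Norm conservation needs the reverse inequality too, obtained by running time backwards with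
    -- `-τ`.
    have hge : ‖ψ (1 - 1)‖ ≤ ‖ψ (1 - 0)‖ + 0 := by
      have hmaps : ∀ s ∈ Icc (0 : ℝ) 1, 1 - s ∈ Icc (0 : ℝ) 1 := fun s hs =>
        ⟨by linarith [hs.2], by linarith [hs.1]⟩
      refine norm_le_add_of_hasDerivWithinAt (d := fun s => ψ (1 - s)) (r := fun _ => 0)
        (H := fun s => H (1 - s)) (τ := -τ) (fun s hs => hsym _ (hmaps s hs)) (fun s hs => ?_)
        (by simp)
      have h := (hψ (1 - s) (hmaps s hs)).scomp s
        ((hasDerivWithinAt_id s (Icc (0 : ℝ) 1)).const_sub 1) hmaps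
      refine h.congr_deriv ?_
      simp
    rw [sub_self, sub_zero, hψ0, level.norm_eq_one 0 h0] at hge
    rw [hψ0, level.norm_eq_one 0 h0] at hle
    linarith
  -- The dynamical phase, which turns the generator `H - E` of `Φ` back into `H`.
  let ε : ℝ → ℂ := fun s => Complex.exp (-(Complex.I * τ) * (θ s : ℂ))
  have hεn : ∀ s, ‖ε s‖ = 1 := fun s => by
    simp [ε, Complex.norm_exp]
  have hεd : ∀ s ∈ Icc (0 : ℝ) 1,
      HasDerivWithinAt ε (ε s * (-(Complex.I * τ) * (E s : ℂ))) (Icc 0 1) s := fun s hs =>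
    ((hθ s hs).ofReal_comp.const_mul _).cexp
  have hdiff : ∀ s ∈ Icc (0 : ℝ) 1, HasDerivWithinAt (fun s => ψ s - ε s • Φ τ s)
      (-(Complex.I * (τ : ℂ)) • H s (ψ s - ε s • Φ τ s) + -(ε s • r τ s)) (Icc 0 1) s := by
    intro s hs
    refine ((hψ s hs).sub (hasDerivWithinAt_bilinear smulBilin (hεd s hs)
      (hd s hs))).congr_deriv ?_
    simp only [smulBilin_apply, map_sub, map_smul]
    module
  have hmain := norm_le_add_of_hasDerivWithinAt hsym hdiff (ρ := δ) (fun s hs => by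
    rw [norm_neg, norm_smul, hεn, one_mul]; exact hr s hs)
  have hε0 : ε 0 = 1 := by simp [ε, hθ0]
  rw [hε0, one_smul, hψ0, ← hy0, norm_sub_rev (y 0)] at hmain
  refine ⟨hψ1, ?_⟩
  have hfin : ‖ψ 1 - (ε 1 * c * c₁) • φ 1‖ ≤ 3 * δ := by
    have e : ψ 1 - (ε 1 * c * c₁) • φ 1
        = (ψ 1 - ε 1 • Φ τ 1) + ε 1 • (Φ τ 1 - c • y 1) := by
      rw [hy1]; module
    rw [e]
    refine (norm_add_le _ _).trans ?_
    rw [norm_smul, hεn, one_mul]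
    linarith
  obtain ⟨z, hz, hzle⟩ := exists_unit_phase_of_norm_sub_le hψ1 (level.norm_eq_one 1 h1) hfin
  refine ⟨z, hz, hzle.trans_eq ?_⟩
  rw [hδ]; ring

end AdiabaticTheorem

/-! ### Trace norm against operator norm. -/

section TraceNormBound

variable {S : Type*} [NormedAddCommGroup S] [InnerProductSpace ℂ S] [FiniteDimensional ℂ S]

theorem traceNorm_le (X : S →L[ℂ] S) : traceNorm X ≤ Module.finrank ℂ S * ‖X‖ := by
  have : CompleteSpace S := FiniteDimensional.complete ℂ S
  set Y : S →L[ℂ] S := CFC.sqrt (star X * X) with hY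
  have hYn : ‖Y‖ = ‖X‖ := by
    rw [hY, CFC.norm_sqrt _ (star_mul_self_nonneg X), CStarRing.norm_star_mul_self,
      Real.sqrt_mul_self (norm_nonneg _)]
  change (LinearMap.trace ℂ S Y.toLinearMap).re ≤ _
  let e := stdOrthonormalBasis ℂ S
  rw [LinearMap.trace_eq_sum_inner _ e, Complex.re_sum]
  have h : ∀ i ∈ Finset.univ, (inner ℂ (e i) (Y (e i))).re ≤ ‖X‖ := fun i _ => by
    refine (Complex.re_le_norm _).trans ((norm_inner_le_norm _ _).trans ?_)
    rw [e.norm_eq_one, one_mul, ← hYn]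
    simpa using Y.le_opNorm (e i)
  refine (Finset.sum_le_card_nsmul _ _ _ h).trans_eq ?_
  simp

end TraceNormBound

/-! ### Norm bounds for the partial trace. -/

section PartialTrace

variable {S B ι : Type*} [NormedAddCommGroup S] [InnerProductSpace ℂ S]
  [NormedAddCommGroup B] [InnerProductSpace ℂ B]

theorem inner_bathBra (u : B) (x : S) (ψ : S ⊗[ℂ] B) :
    inner ℂ x (bathBra u ψ) = inner ℂ (x ⊗ₜ[ℂ] u) ψ := by
  induction ψ using TensorProduct.induction_on with
  | zero => simp
  | tmul y v => simp [bathBra_tmul, mul_comm]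
  | add ψ₁ ψ₂ h₁ h₂ => rw [map_add, inner_add_right, inner_add_right, h₁, h₂]

theorem orthonormal_tmul_left {b : ι → B} (hb : Orthonormal ℂ b) {x : S} (hx : ‖x‖ = 1) :
    Orthonormal ℂ fun i => x ⊗ₜ[ℂ] b i := by
  classical
  rw [orthonormal_iff_ite] at hb ⊢
  intro i j
  rw [TensorProduct.inner_tmul, hb i j, inner_self_eq_one hx, one_mul]

theorem sum_inner_tmul_sq_le {b : ι → B} (hb : Orthonormal ℂ b) (x : S) (ψ : S ⊗[ℂ] B)
    (s : Finset ι) : ∑ i ∈ s, ‖inner ℂ (x ⊗ₜ[ℂ] b i) ψ‖ ^ 2 ≤ (‖x‖ * ‖ψ‖) ^ 2 := by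
  by_cases hx : x = 0
  · simp [hx]
  have hx' : (‖x‖ : ℂ) ≠ 0 := by simpa using hx
  let u : S := (‖x‖ : ℂ)⁻¹ • x
  have hu : ‖u‖ = 1 := by simp [u, norm_smul, hx]
  have hxu : x = (‖x‖ : ℂ) • u := by simp [u, smul_smul, hx]
  have h := (orthonormal_tmul_left hb hu).sum_inner_products_le (x := ψ) (s := s)
  calc ∑ i ∈ s, ‖inner ℂ (x ⊗ₜ[ℂ] b i) ψ‖ ^ 2
      = ‖x‖ ^ 2 * ∑ i ∈ s, ‖inner ℂ (u ⊗ₜ[ℂ] b i) ψ‖ ^ 2 := by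
        rw [Finset.mul_sum]
        refine Finset.sum_congr rfl fun i _ => ?_
        rw [← inner_bathBra, ← inner_bathBra]
        conv_lhs => rw [hxu, inner_smul_left]
        simp [mul_pow]
    _ ≤ ‖x‖ ^ 2 * ‖ψ‖ ^ 2 := by gcongr
    _ = (‖x‖ * ‖ψ‖) ^ 2 := (mul_pow _ _ _).symm

theorem reducedState_phase (b : HilbertBasis ι ℂ B) (ψ : S ⊗[ℂ] B) {z : ℂ} (hz : ‖z‖ = 1) :
    reducedState b (z • ψ) = reducedState b ψ := by
  rw [reducedState, rankOne_smul_self_of_unit hz, reducedState]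

variable [CompleteSpace B]

theorem hasSum_partialTrace (b : HilbertBasis ι ℂ B) (ψ χ : S ⊗[ℂ] B) :
    HasSum (fun i => bathBra (b i) ∘L (rankOne ℂ ψ χ) ∘L bathKet (b i))
      (partialTrace b (rankOne ℂ ψ χ)) := by
  obtain ⟨R, hR⟩ := exists_hasSum_partialTrace_rankOne (ι := ι) ψ χ
  exact (hR b).summable.hasSum

/-- Cauchy–Schwarz over the bath basis, then Bessel for the orthonormal families `x ⊗ bᵢ` and `y ⊗
bᵢ` with `x`, `y` normalised. -/
theorem norm_partialTrace_rankOne_le (b : HilbertBasis ι ℂ B) (ψ χ : S ⊗[ℂ] B) :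
    ‖partialTrace b (rankOne ℂ ψ χ)‖ ≤ ‖ψ‖ * ‖χ‖ := by
  set R := partialTrace b (rankOne ℂ ψ χ) with hR
  have key : ∀ x y : S, ‖inner ℂ x (R y)‖ ≤ (‖x‖ * ‖ψ‖) * (‖y‖ * ‖χ‖) := by
    intro x y
    have hs : HasSum (fun i => inner ℂ (x ⊗ₜ[ℂ] b i) ψ * inner ℂ χ (y ⊗ₜ[ℂ] b i))
        (inner ℂ x (R y)) := by
      have h := ((innerSL ℂ x) ∘L (ContinuousLinearMap.apply ℂ S y)).hasSum
        (hasSum_partialTrace b ψ χ)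
      refine h.congr_fun fun i => ?_
      change _ = inner ℂ x (bathBra (b i) (inner ℂ χ (y ⊗ₜ[ℂ] b i) • ψ))
      rw [map_smul, inner_smul_right, inner_bathBra, mul_comm]
    refine le_of_tendsto hs.norm (Eventually.of_forall fun s => ?_)
    refine (norm_sum_le _ _).trans ?_
    have h2 : ∀ i, ‖inner ℂ (x ⊗ₜ[ℂ] b i) ψ * inner ℂ χ (y ⊗ₜ[ℂ] b i)‖
        = ‖inner ℂ (x ⊗ₜ[ℂ] b i) ψ‖ * ‖inner ℂ (y ⊗ₜ[ℂ] b i) χ‖ := fun i => by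
      rw [norm_mul, norm_inner_symm χ]
    simp only [h2]
    refine abs_le_of_sq_le_sq' ?_ (by positivity) |>.2
    refine (Finset.sum_mul_sq_le_sq_mul_sq s _ _).trans ?_
    rw [mul_pow]
    gcongr
    · exact sum_inner_tmul_sq_le b.orthonormal x ψ s
    · exact sum_inner_tmul_sq_le b.orthonormal y χ s
  refine R.opNorm_le_bound (by positivity) fun y => ?_
  have h := key (R y) y
  rw [inner_self_eq_norm_sq_to_K] at h
  have h' : ‖R y‖ * ‖R y‖ ≤ ‖R y‖ * (‖ψ‖ * ‖χ‖ * ‖y‖) := by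
    simp only [norm_pow, Complex.coe_algebraMap, Complex.norm_real, norm_norm] at h
    nlinarith
  rcases (norm_nonneg (R y)).eq_or_lt with h0 | h0
  · rw [← h0]; positivity
  · exact le_of_mul_le_mul_left h' h0

theorem norm_reducedState_sub_le (b : HilbertBasis ι ℂ B) (ψ χ : S ⊗[ℂ] B) :
    ‖reducedState b ψ - reducedState b χ‖ ≤ ‖ψ - χ‖ * (‖ψ‖ + ‖χ‖) := by
  have h : reducedState b ψ - reducedState b χ
      = partialTrace b (rankOne ℂ (ψ - χ) ψ) + partialTrace b (rankOne ℂ χ (ψ - χ)) := by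
    refine ((hasSum_partialTrace b ψ ψ).sub (hasSum_partialTrace b χ χ)).unique ?_
    refine ((hasSum_partialTrace b (ψ - χ) ψ).add
      (hasSum_partialTrace b χ (ψ - χ))).congr_fun fun i => ?_
    rw [← ContinuousLinearMap.comp_sub, ← ContinuousLinearMap.sub_comp, rankOne_self_sub,
      ContinuousLinearMap.add_comp, ContinuousLinearMap.comp_add]
  rw [h]
  refine (norm_add_le _ _).trans ((add_le_add (norm_partialTrace_rankOne_le b _ _)
    (norm_partialTrace_rankOne_le b _ _)).trans_eq ?_)
  ring

end PartialTrace

/-! ### Transfer of smoothness and flatness to the total Hamiltonian. -/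

section AffineHamiltonian

variable {S K : Type*} [NormedAddCommGroup S] [InnerProductSpace ℂ S]
  [NormedAddCommGroup K] [InnerProductSpace ℂ K]

theorem contDiffOn_clm_add_const {f : ℝ → S →L[ℂ] S} {n : WithTop ℕ∞} {s : Set ℝ}
    (h : ContDiffOn ℝ n f s) (L : (S →L[ℂ] S) →L[ℂ] (K →L[ℂ] K)) (A : K →L[ℂ] K) :
    ContDiffOn ℝ n (fun t => L (f t) + A) s :=
  ((L.restrictScalars ℝ).contDiff.comp_contDiffOn h).add contDiffOn_const

theorem flatAtEnds_derivWithin_clm_add_const {f : ℝ → S →L[ℂ] S} {k : ℕ}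
    (h : ContDiffOn ℝ (k + 1 : ℕ) f (Icc 0 1))
    (hflat : FlatAtEnds k (derivWithin f (Icc 0 1)))
    (L : (S →L[ℂ] S) →L[ℂ] (K →L[ℂ] K)) (A : K →L[ℂ] K) :
    FlatAtEnds k (derivWithin (fun t => L (f t) + A) (Icc 0 1)) := by
  refine (hflat.clm_comp (L.restrictScalars ℝ) (contDiffOn_derivWithin_unitInterval h)
    (by omega)).congr fun s hs => ?_
  exact (((L.restrictScalars ℝ).hasFDerivAt.comp_hasDerivWithinAt s
    (hasDerivWithinAt_of_contDiffOn_succ h hs)).add_const A).derivWithin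
      (uniqueDiffOn_unitInterval s hs)

end AffineHamiltonian

/-! ### Completeness and symmetry on the composite space. -/

section Composite

variable {S B : Type*} [NormedAddCommGroup S] [InnerProductSpace ℂ S]
  [NormedAddCommGroup B] [InnerProductSpace ℂ B]

/-- An orthonormal basis of `S` identifies the tensor product with a finite power of `B`. -/
theorem completeSpace_tensorProduct [FiniteDimensional ℂ S] [CompleteSpace B] :
    CompleteSpace (S ⊗[ℂ] B) := by
  let e := stdOrthonormalBasis ℂ S
  let f : S ⊗[ℂ] B →L[ℂ] (Fin (Module.finrank ℂ S) → B) := ContinuousLinearMap.pi fun i =>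
    ((TensorProduct.lidIsometry ℂ B).toContinuousLinearEquiv : ℂ ⊗[ℂ] B →L[ℂ] B) ∘L
      (innerSL ℂ (e i)).rTensor B
  let g : (Fin (Module.finrank ℂ S) → B) →L[ℂ] S ⊗[ℂ] B :=
    ∑ i, (TensorProduct.mkL ℂ S B (e i)) ∘L ContinuousLinearMap.proj i
  have hf : ∀ x u i, f (x ⊗ₜ[ℂ] u) i = inner ℂ (e i) x • u := fun x u i => by simp [f]
  have hg : ∀ v, g v = ∑ i, e i ⊗ₜ[ℂ] v i := fun v => by simp [g]
  have hgf : Function.LeftInverse g f := fun ψ => by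
    induction ψ using TensorProduct.induction_on with
    | zero => simp
    | tmul x u =>
      rw [hg]
      simp only [hf, ← TensorProduct.smul_tmul, ← TensorProduct.sum_tmul]
      rw [e.sum_repr']
    | add ψ₁ ψ₂ h₁ h₂ => rw [map_add, map_add, h₁, h₂]
  have hfg : Function.RightInverse g f := fun v => by
    ext i
    classical
    rw [hg, map_sum, Finset.sum_apply]
    simp [hf, orthonormal_iff_ite.1 e.orthonormal]
  let F : S ⊗[ℂ] B ≃L[ℂ] (Fin (Module.finrank ℂ S) → B) :=
    ContinuousLinearEquiv.equivOfInverse f g hgf hfg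
  exact (completeSpace_congr (e := F.toEquiv) F.isUniformEmbedding).2 inferInstance

theorem isSymmetric_rTensor {T : S →L[ℂ] S} (hT : T.toLinearMap.IsSymmetric) :
    (T.rTensor B).toLinearMap.IsSymmetric := by
  intro ψ χ
  induction ψ using TensorProduct.induction_on with
  | zero => simp
  | add ψ₁ ψ₂ h₁ h₂ => rw [map_add, inner_add_left, inner_add_left, h₁, h₂]
  | tmul x u =>
    induction χ using TensorProduct.induction_on with
    | zero => simp
    | add χ₁ χ₂ h₁ h₂ => rw [map_add, inner_add_right, inner_add_right, h₁, h₂]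
    | tmul y v =>
      have := hT x y
      simp only [ContinuousLinearMap.coe_coe] at this
      simp [this]

theorem isSymmetric_lTensor {T : B →L[ℂ] B} (hT : T.toLinearMap.IsSymmetric) :
    (T.lTensor S).toLinearMap.IsSymmetric := by
  intro ψ χ
  induction ψ using TensorProduct.induction_on with
  | zero => simp
  | add ψ₁ ψ₂ h₁ h₂ => rw [map_add, inner_add_left, inner_add_left, h₁, h₂]
  | tmul x u =>
    induction χ using TensorProduct.induction_on with
    | zero => simp
    | add χ₁ χ₂ h₁ h₂ => rw [map_add, inner_add_right, inner_add_right, h₁, h₂]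
    | tmul y v =>
      have := hT u v
      simp only [ContinuousLinearMap.coe_coe] at this
      simp [this]

theorem isSymmetric_totalHamiltonian {HS : S →L[ℂ] S} {HB : B →L[ℂ] B}
    {HI : S ⊗[ℂ] B →L[ℂ] S ⊗[ℂ] B} (hS : HS.toLinearMap.IsSymmetric)
    (hB : HB.toLinearMap.IsSymmetric) (hI : HI.toLinearMap.IsSymmetric) :
    (totalHamiltonian HS HB HI).toLinearMap.IsSymmetric :=
  ((isSymmetric_rTensor hS).add (isSymmetric_lTensor hB)).add hI

/-- `T ↦ T ⊗ 1` as a bounded linear map of operators. -/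
noncomputable def rTensorL (S B : Type*) [NormedAddCommGroup S] [InnerProductSpace ℂ S]
    [NormedAddCommGroup B] [InnerProductSpace ℂ B] :
    (S →L[ℂ] S) →L[ℂ] (S ⊗[ℂ] B →L[ℂ] S ⊗[ℂ] B) :=
  LinearMap.mkContinuous
    { toFun := fun T : S →L[ℂ] S => T.rTensor B
      map_add' := fun T U => ContinuousLinearMap.rTensor_add B T U
      map_smul' := fun c T => by
        refine ContinuousLinearMap.ext fun ψ => ?_
        change (c • T).rTensor B ψ = c • T.rTensor B ψ
        induction ψ using TensorProduct.induction_on with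
        | zero => simp
        | tmul x u => rfl
        | add ψ₁ ψ₂ h₁ h₂ => rw [map_add, map_add, h₁, h₂, smul_add] } 1
    fun T => by simpa using ContinuousLinearMap.norm_rTensor_le (G := B) T

theorem totalHamiltonian_eq (HS : S →L[ℂ] S) (HB : B →L[ℂ] B)
    (HI : S ⊗[ℂ] B →L[ℂ] S ⊗[ℂ] B) :
    totalHamiltonian HS HB HI = rTensorL S B HS + (HB.lTensor S + HI) :=
  add_assoc _ _ _

end Composite

end AdiabaticBoundary

/-! ### The bound for the reduced states. -/

theorem proposition6
    {S B ι : Type*}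
    [NormedAddCommGroup S] [InnerProductSpace ℂ S] [FiniteDimensional ℂ S]
    [NormedAddCommGroup B] [InnerProductSpace ℂ B] [CompleteSpace B]
    (b : HilbertBasis ι ℂ B) (k : ℕ)
    (HS : ℝ → S →L[ℂ] S) (HB : B →L[ℂ] B) (HI : S ⊗[ℂ] B →L[ℂ] S ⊗[ℂ] B)
    (HS_symm : ∀ s ∈ Set.Icc (0 : ℝ) 1, (HS s).toLinearMap.IsSymmetric)
    (HB_symm : HB.toLinearMap.IsSymmetric)
    (HI_symm : HI.toLinearMap.IsSymmetric)
    (HS_smooth : ContDiffOn ℝ ((k + 2 : ℕ) : WithTop ℕ∞) HS (Set.Icc 0 1))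
    (E : ℝ → ℝ) (φ : ℝ → S ⊗[ℂ] B)
    (level : AdiabaticBoundary.IsGappedLevel
      (fun s => AdiabaticBoundary.totalHamiltonian (HS s) HB HI) E φ)
    (HS_deriv_zero : ∀ j : ℕ, 1 ≤ j → j ≤ k → iteratedDerivWithin j HS (Set.Icc 0 1) 0 = 0)
    (HS_deriv_one : ∀ j : ℕ, 1 ≤ j → j ≤ k → iteratedDerivWithin j HS (Set.Icc 0 1) 1 = 0) :
    ∃ C : ℝ, ∀ τ : ℝ, 0 < τ → ∀ ψ : ℝ → S ⊗[ℂ] B,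
      AdiabaticBoundary.IsSchrodingerSolution
        (fun s => AdiabaticBoundary.totalHamiltonian (HS s) HB HI) τ ψ →
      ψ 0 = φ 0 →
      AdiabaticBoundary.traceNorm
          (AdiabaticBoundary.reducedState b (ψ 1) - AdiabaticBoundary.reducedState b (φ 1))
        ≤ C / τ ^ (k + 1) := by
  have : CompleteSpace (S ⊗[ℂ] B) := AdiabaticBoundary.completeSpace_tensorProduct
  have hflat : AdiabaticBoundary.FlatAtEnds k (derivWithin HS (Set.Icc 0 1)) := by
    intro i hi x hx
    rw [← iteratedDerivWithin_succ']
    rcases hx with rfl | rfl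
    · exact HS_deriv_zero (i + 1) (by omega) (by omega)
    · exact HS_deriv_one (i + 1) (by omega) (by omega)
  have hsymm := fun s hs =>
    AdiabaticBoundary.isSymmetric_totalHamiltonian (HS_symm s hs) HB_symm HI_symm
  simp only [AdiabaticBoundary.totalHamiltonian_eq] at level hsymm ⊢
  obtain ⟨C, hC⟩ := AdiabaticBoundary.exists_adiabatic_bound level hsymm
    (AdiabaticBoundary.contDiffOn_clm_add_const HS_smooth _ _)
    (AdiabaticBoundary.flatAtEnds_derivWithin_clm_add_const
      (AdiabaticBoundary.contDiffOn_of_nat_le HS_smooth (by omega)) hflat _ _)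
  -- The dimension comes from `traceNorm_le`; the 2 is `‖ψ 1‖ + ‖z • φ 1‖`.
  refine ⟨Module.finrank ℂ S * (C * 2), fun τ hτ ψ hψ hψ0 => ?_⟩
  obtain ⟨hψ1, z, hz, hle⟩ := hC τ hτ ψ hψ hψ0
  refine (AdiabaticBoundary.traceNorm_le _).trans ?_
  rw [← AdiabaticBoundary.reducedState_phase b (φ 1) hz, mul_div_assoc]
  gcongr
  refine (AdiabaticBoundary.norm_reducedState_sub_le b _ _).trans ?_
  rw [hψ1, norm_smul, hz, level.norm_eq_one 1 (by simp), one_mul, one_add_one_eq_two,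
    mul_div_right_comm]
  gcongr
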